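/- Let $\mathbb{K}$ be a field of characteristic $0$. A *semi-strict Lie $2$-algebra* over $\mathbb K$ is a category object $L$ in $\mathbb K$-vector spaces (a $2$-vector space), with a skew-symmetric bilinear functor $[\,,]:L\times L\to L$ and a completely antisymmetric trilinear natural isomorphism $J_{x,y,z}:[[x,y],z]\to[x,[y,z]]+[[x,z],y]$ satisfying the Jacobiator identity of Baez and Crans: with composites written in diagrammatic order and $1$ denoting the identity arrows that make them defined, $$J_{[w,x],y,z}\,\big([J_{w,x,z},y]+1\big)\,\big(J_{w,[x,z],y}+J_{[w,z],x,y}+J_{w,x,[y,z]}\big)=[J_{w,x,y},z]\,\big(J_{[w,y],x,z}+J_{w,[x,y],z}\big)\,\big([J_{w,y,z},x]+1\big)\,\big([w,J_{x,y,z}]+1\big)$$ for all objects $w,x,y,z$. Semi-strict Lie $2$-algebras form a $2$-category. Its morphisms are linear functors $F$ with a skew-symmetric bilinear natural transformation $F_2(x,y):[Fx,Fy]\to F[x,y]$ compatible with the Jacobiators. Its $2$-morphisms are linear natural transformations compatible with $F_2$. Two objects are *equivalent* if there are morphisms in both directions whose two composites are isomorphic to the identities by invertible $2$-morphisms. A *strict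 Lie $2$-algebra* is a category object in Lie algebras over $\mathbb K$, with source, target and identity maps $s,t:\mathfrak g_{-1}\to\mathfrak g_0$ and $i:\mathfrak g_0\to\mathfrak g_{-1}$. It is regarded as a semi-strict one with its Lie brackets and identity Jacobiator. Its *crossed module* is $\mu=t|_{\mathfrak h}:\mathfrak h=\ker(s)\to\mathfrak g=\mathfrak g_0$, with action $g\cdot h=[i(g),h]$ of $\mathfrak g$ on $\mathfrak h$ by derivations. The image $\mu(\mathfrak h)$ is an ideal of $\mathfrak g$, and the *outer action* of the crossed module is the Lie algebra homomorphism $\mathfrak g/\mu(\mathfrak h)\to\mathfrak{out}(\mathfrak h)=\mathfrak{der}(\mathfrak h)/\mathrm{ad}(\mathfrak h)$ that sends the class of $g$ to the class of $h\mapsto g\cdot h$. **Statement.** Every semi-strict Lie $2$-algebra over $\mathbb K$ is equivalent, in this $2$-category, to a strict Lie $2$-algebra whose crossed module $\mu:\mathfrak h\to\mathfrak g$ has the following properties: 1. the Lie algebra $\mathfrak h$ is abelian; 2. $\mathfrak h$ is a $\mathfrak g/\mu(\mathfrak h)$-module via $(g+\mu(\mathfrak h))\cdot h=g\cdot h$;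 3. the outer action is a genuine action, i.e. it lifts to a Lie algebra homomorphism $\mathfrak g/\mu(\mathfrak h)\to\mathfrak{der}(\mathfrak h)$ that sends the class of $g$ to $h\mapsto g\cdot h$. -/

import Mathlib

universe v u u₁ u₂ u₃

namespace LieTwo

/-! ## Two-vector spaces: category objects in vector spaces -/

/-- A `2`-vector space over `K`: a category object in the category of `K`-vector spaces.  It has
a space of objects, a space of arrows, linear source, target and identity maps, and a linear
composition defined on the pullback of composable pairs.  Composition is in diagrammatic order:
`m (f, g)`, with `f : x ⟶ y` and `g : y ⟶ z`, is an arrow `x ⟶ z`. -/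
structure TwoVectorSpace (K : Type v) [Field K] where
  Obj : Type u
  Arr : Type u
  [objAddCommGroup : AddCommGroup Obj]
  [objModule : Module K Obj]
  [arrAddCommGroup : AddCommGroup Arr]
  [arrModule : Module K Arr]
  /-- source -/
  s : Arr →ₗ[K] Obj
  /-- target -/
  t : Arr →ₗ[K] Obj
  /-- object inclusion (identity arrows) -/
  i : Obj →ₗ[K] Arr
  /-- composition -/
  m : ↥(LinearMap.eqLocus (t ∘ₗ LinearMap.fst K Arr Arr) (s ∘ₗ LinearMap.snd K Arr Arr))
        →ₗ[K] Arr
  s_i : ∀ x, s (i x) = x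
  t_i : ∀ x, t (i x) = x
  s_m : ∀ p, s (m p) = s p.1.1
  t_m : ∀ p, t (m p) = t p.1.2
  i_m : ∀ f, m ⟨(i (s f), f), t_i (s f)⟩ = f
  m_i : ∀ f, m ⟨(f, i (t f)), (s_i (t f)).symm⟩ = f
  m_assoc : ∀ (f g h : Arr) (hfg : t f = s g) (hgh : t g = s h),
    m ⟨(m ⟨(f, g), hfg⟩, h), (t_m _).trans hgh⟩ =
      m ⟨(f, m ⟨(g, h), hgh⟩), hfg.trans (s_m ⟨(g, h), hgh⟩).symm⟩

attribute [instance] TwoVectorSpace.objAddCommGroup TwoVectorSpace.objModule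
  TwoVectorSpace.arrAddCommGroup TwoVectorSpace.arrModule

namespace TwoVectorSpace

variable {K : Type v} [Field K] (V : TwoVectorSpace.{v, u} K)

/-- The composite of two composable arrows, in diagrammatic order. -/
def comp (f g : V.Arr) (h : V.t f = V.s g) : V.Arr := V.m ⟨(f, g), h⟩

/-- The arrow part of an arrow. -/
def arrowPart (f : V.Arr) : V.Arr := f - V.i (V.s f)

theorem s_comp (f g : V.Arr) (h : V.t f = V.s g) : V.s (V.comp f g h) = V.s f := V.s_m _

theorem t_comp (f g : V.Arr) (h : V.t f = V.s g) : V.t (V.comp f g h) = V.t g := V.t_m _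

/-- The composition is determined by the rest of the structure. -/
theorem comp_eq (f g : V.Arr) (h : V.t f = V.s g) : V.comp f g h = f + g - V.i (V.t f) := by
  have h0 : V.t (0 : V.Arr) = V.s (g - V.i (V.t f)) := by
    rw [map_zero, map_sub, V.s_i, h, sub_self]
  have h1 : V.comp f g h = V.m ⟨(f, V.i (V.t f)), (V.s_i (V.t f)).symm⟩
      + V.m ⟨(0, g - V.i (V.t f)), h0⟩ := by
    rw [← map_add]
    unfold comp
    congr 1
    apply Subtype.ext
    simp
  have h2 : V.m ⟨(0, g - V.i (V.t f)), h0⟩ = g - V.i (V.t f) := by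
    have h3 := V.i_m (g - V.i (V.t f))
    have h4 : V.s (g - V.i (V.t f)) = 0 := by rw [← h0, map_zero]
    refine Eq.trans (congrArg V.m (Subtype.ext ?_)) h3
    simp only [h4, map_zero]
  rw [h1, h2, V.m_i]
  abel

/-- Every arrow of a `2`-vector space is invertible; in particular natural transformations
between linear functors of `2`-vector spaces are automatically natural isomorphisms. -/
theorem exists_inverse (f : V.Arr) :
    ∃ (g : V.Arr) (hfg : V.t f = V.s g) (hgf : V.t g = V.s f),
      V.comp f g hfg = V.i (V.s f) ∧ V.comp g f hgf = V.i (V.t f) := by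
  refine ⟨V.i (V.s f) + V.i (V.t f) - f, by simp [V.s_i], by simp [V.t_i], ?_, ?_⟩
  · rw [comp_eq]; abel
  · rw [comp_eq]; simp [V.t_i]

end TwoVectorSpace

/-- A linear functor between `2`-vector spaces (an internal functor). -/
structure LinearFunctor {K : Type v} [Field K] (V : TwoVectorSpace.{v, u₁} K)
    (W : TwoVectorSpace.{v, u₂} K) where
  obj : V.Obj →ₗ[K] W.Obj
  arr : V.Arr →ₗ[K] W.Arr
  s_arr : ∀ f, W.s (arr f) = obj (V.s f)
  t_arr : ∀ f, W.t (arr f) = obj (V.t f)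
  arr_i : ∀ x, arr (V.i x) = W.i (obj x)
  arr_comp : ∀ (f g : V.Arr) (h : V.t f = V.s g),
    arr (V.comp f g h) = W.comp (arr f) (arr g) (by rw [t_arr, s_arr, h])

/-! ## Semi-strict Lie 2-algebras -/

/-- A `2`-vector space with a skew-symmetric bilinear functorial bracket (`br₀` on objects, `br₁`
on arrows) and a completely antisymmetric trilinear natural isomorphism
`J x y z : [[x, y], z] ⟶ [x, [y, z]] + [[x, z], y]`, the Jacobiator.  (Invertibility of `J` is
automatic, by `TwoVectorSpace.exists_inverse`; an `n`-linear natural transformation is called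
completely antisymmetric if its arrow part is.) -/
structure BracketTwoVectorSpace (K : Type v) [Field K] where
  /-- the underlying `2`-vector space -/
  V : TwoVectorSpace.{v, u} K
  /-- the bracket on objects -/
  br₀ : V.Obj →ₗ[K] V.Obj →ₗ[K] V.Obj
  /-- the bracket on arrows -/
  br₁ : V.Arr →ₗ[K] V.Arr →ₗ[K] V.Arr
  br₀_skew : ∀ x y, br₀ x y = -br₀ y x
  br₁_skew : ∀ f g, br₁ f g = -br₁ g f
  s_br : ∀ f g, V.s (br₁ f g) = br₀ (V.s f) (V.s g)
  t_br : ∀ f g, V.t (br₁ f g) = br₀ (V.t f) (V.t g)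
  br_i : ∀ x y, br₁ (V.i x) (V.i y) = V.i (br₀ x y)
  br_comp : ∀ (f f' g g' : V.Arr) (hf : V.t f = V.s f') (hg : V.t g = V.s g'),
    br₁ (V.comp f f' hf) (V.comp g g' hg) =
      V.comp (br₁ f g) (br₁ f' g') (by rw [t_br, s_br, hf, hg])
  /-- the Jacobiator -/
  J : V.Obj →ₗ[K] V.Obj →ₗ[K] V.Obj →ₗ[K] V.Arr
  s_J : ∀ x y z, V.s (J x y z) = br₀ (br₀ x y) z
  t_J : ∀ x y z, V.t (J x y z) = br₀ x (br₀ y z) + br₀ (br₀ x z) y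
  J_natural : ∀ f g h : V.Arr,
    V.comp (br₁ (br₁ f g) h) (J (V.t f) (V.t g) (V.t h))
        (by rw [t_br, t_br, s_J]) =
      V.comp (J (V.s f) (V.s g) (V.s h)) (br₁ f (br₁ g h) + br₁ (br₁ f h) g)
        (by rw [t_J, map_add, s_br, s_br, s_br, s_br])
  J_antisymm_left : ∀ x y z,
    V.arrowPart (J y x z) = -V.arrowPart (J x y z)
  J_antisymm_right : ∀ x y z,
    V.arrowPart (J x z y) = -V.arrowPart (J x y z)

namespace BracketTwoVectorSpace

variable {K : Type v} [Field K] (L : BracketTwoVectorSpace.{v, u} K)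

/-- The first composite in the Jacobiator identity, from `[[[w, x], y], z]` to
`[w, [x, [y, z]]] + [w, [[x, z], y]] + [[w, z], [x, y]] + [[w, y], [x, z]] + [[w, [y, z]], x]
+ [[[w, z], y], x]`. -/
def jacobiatorLeft (w x y z : L.V.Obj) : L.V.Arr :=
  L.V.comp
    (L.V.comp
      (L.J (L.br₀ w x) y z)
      (L.br₁ (L.J w x z) (L.V.i y) + L.V.i (L.br₀ (L.br₀ w x) (L.br₀ y z)))
      (by simp only [L.t_J, map_add, L.s_br, L.s_J, L.V.s_i]; abel))
    (L.J w (L.br₀ x z) y + L.J (L.br₀ w z) x y + L.J w x (L.br₀ y z))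
    (by simp only [L.V.t_comp, map_add, LinearMap.add_apply, L.t_br, L.t_J, L.V.t_i, L.s_J])

/-- The second composite in the Jacobiator identity, with the same source and target. -/
def jacobiatorRight (w x y z : L.V.Obj) : L.V.Arr :=
  L.V.comp
    (L.V.comp
      (L.V.comp
        (L.br₁ (L.J w x y) (L.V.i z))
        (L.J (L.br₀ w y) x z + L.J w (L.br₀ x y) z)
        (by simp only [map_add, LinearMap.add_apply, L.t_br, L.t_J, L.V.t_i, L.s_J]; abel))
      (L.br₁ (L.J w y z) (L.V.i x) +
        L.V.i (L.br₀ (L.br₀ w y) (L.br₀ x z) + L.br₀ w (L.br₀ (L.br₀ x y) z) +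
          L.br₀ (L.br₀ w z) (L.br₀ x y)))
      (by simp only [L.V.t_comp, map_add, L.s_br, L.t_J, L.V.s_i, L.s_J]; abel))
    (L.br₁ (L.V.i w) (L.J x y z) +
      L.V.i (L.br₀ (L.br₀ w y) (L.br₀ x z) + L.br₀ (L.br₀ w z) (L.br₀ x y) +
        L.br₀ (L.br₀ w (L.br₀ y z)) x + L.br₀ (L.br₀ (L.br₀ w z) y) x))
    (by
      simp only [L.V.t_comp, map_add, LinearMap.add_apply, L.t_br, L.t_J, L.V.t_i, L.s_br,
        L.s_J, L.V.s_i]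
      abel)

/-- If the Jacobi identity holds strictly and the Jacobiator consists of identity arrows, then the
Jacobiator identity holds. -/
theorem jacobiator_identity_of_identities
    (hJ : ∀ x y z, L.J x y z = L.V.i (L.br₀ (L.br₀ x y) z))
    (hb : ∀ x y z, L.br₀ (L.br₀ x y) z = L.br₀ x (L.br₀ y z) + L.br₀ (L.br₀ x z) y)
    (w x y z : L.V.Obj) : L.jacobiatorLeft w x y z = L.jacobiatorRight w x y z := by
  have h1 := congrArg L.V.i (hb (L.br₀ w x) y z)
  have h2 := congrArg (fun a => L.V.i (L.br₀ a y)) (hb w x z)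
  have h3 := congrArg (fun a => L.V.i (L.br₀ a z)) (hb w x y)
  have h4 := congrArg L.V.i (hb (L.br₀ w y) x z)
  have h5 := congrArg L.V.i (hb w (L.br₀ x y) z)
  have h6 := congrArg (fun a => L.V.i (L.br₀ a x)) (hb w y z)
  simp only [map_add, LinearMap.add_apply] at h1 h2 h3 h4 h5 h6
  simp only [jacobiatorLeft, jacobiatorRight, TwoVectorSpace.comp_eq, hJ, L.br_i, map_add,
    map_sub, L.V.t_i]
  grind

end BracketTwoVectorSpace

/-- A semi-strict Lie `2`-algebra: a `2`-vector space with a bracket and a Jacobiator which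
satisfies the Jacobiator identity. -/
structure SemistrictLieTwoAlgebra (K : Type v) [Field K]
    extends BracketTwoVectorSpace.{v, u} K where
  jacobiator_identity : ∀ w x y z : V.Obj,
    toBracketTwoVectorSpace.jacobiatorLeft w x y z =
      toBracketTwoVectorSpace.jacobiatorRight w x y z

namespace SemistrictLieTwoAlgebra

variable {K : Type v} [Field K]

/-- A homomorphism of semi-strict Lie `2`-algebras: a linear functor `F` with a skew-symmetric
bilinear natural transformation `F₂ x y : [F x, F y] ⟶ F [x, y]` compatible with the
Jacobiators. -/
structure Hom (L : SemistrictLieTwoAlgebra.{v, u₁} K) (L' : SemistrictLieTwoAlgebra.{v, u₂} K)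
    extends LinearFunctor L.V L'.V where
  F₂ : L.V.Obj →ₗ[K] L.V.Obj →ₗ[K] L'.V.Arr
  s_F₂ : ∀ x y, L'.V.s (F₂ x y) = L'.br₀ (obj x) (obj y)
  t_F₂ : ∀ x y, L'.V.t (F₂ x y) = obj (L.br₀ x y)
  F₂_natural : ∀ f g : L.V.Arr,
    L'.V.comp (L'.br₁ (arr f) (arr g)) (F₂ (L.V.t f) (L.V.t g))
        (by rw [L'.t_br, t_arr, t_arr, s_F₂]) =
      L'.V.comp (F₂ (L.V.s f) (L.V.s g)) (arr (L.br₁ f g))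
        (by rw [t_F₂, s_arr, L.s_br])
  F₂_skew : ∀ x y, F₂ x y = -F₂ y x
  F₂_jacobiator : ∀ x y z,
    L'.V.comp
      (L'.V.comp
        (L'.J (obj x) (obj y) (obj z))
        (L'.br₁ (L'.V.i (obj x)) (F₂ y z) + L'.br₁ (F₂ x z) (L'.V.i (obj y)))
        (by rw [L'.t_J, map_add, L'.s_br, L'.s_br, L'.V.s_i, L'.V.s_i, s_F₂, s_F₂]))
      (F₂ x (L.br₀ y z) + F₂ (L.br₀ x z) y)
      (by rw [L'.V.t_comp, map_add, map_add, L'.t_br, L'.t_br, L'.V.t_i, L'.V.t_i, t_F₂, t_F₂, s_F₂,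
            s_F₂])
    =
    L'.V.comp
      (L'.V.comp
        (L'.br₁ (F₂ x y) (L'.V.i (obj z)))
        (F₂ (L.br₀ x y) z)
        (by rw [L'.t_br, t_F₂, L'.V.t_i, s_F₂]))
      (arr (L.J x y z))
      (by rw [L'.V.t_comp, t_F₂, s_arr, L.s_J])

/-- The identity homomorphism. -/
def Hom.id (L : SemistrictLieTwoAlgebra.{v, u} K) : Hom L L where
  obj := LinearMap.id
  arr := LinearMap.id
  s_arr _ := rfl
  t_arr _ := rfl
  arr_i _ := rfl
  arr_comp _ _ _ := rfl
  F₂ := L.br₀.compr₂ L.V.i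
  s_F₂ x y := by simp [L.V.s_i]
  t_F₂ x y := by simp [L.V.t_i]
  F₂_natural f g := by
    simp only [TwoVectorSpace.comp_eq, LinearMap.compr₂_apply, LinearMap.id_apply, L.t_br,
      L.V.t_i]
    abel
  F₂_skew x y := by
    rw [LinearMap.compr₂_apply, LinearMap.compr₂_apply, L.br₀_skew x y, map_neg]
  F₂_jacobiator x y z := by
    simp only [TwoVectorSpace.comp_eq, LinearMap.compr₂_apply, LinearMap.id_apply, L.V.t_i,
      L.br_i, map_add, map_sub, L.t_J]
    abel

/-- The composite of `F : L ⟶ L'` and `G : L' ⟶ L''`; its bilinear natural transformation is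
`[G F x, G F y] ⟶ G [F x, F y] ⟶ G F [x, y]`, the composite of `G₂` with the image of `F₂`
under `G`. -/
def Hom.comp {L : SemistrictLieTwoAlgebra.{v, u₁} K} {L' : SemistrictLieTwoAlgebra.{v, u₂} K}
    {L'' : SemistrictLieTwoAlgebra.{v, u₃} K} (F : Hom L L') (G : Hom L' L'') : Hom L L'' where
  obj := G.obj ∘ₗ F.obj
  arr := G.arr ∘ₗ F.arr
  s_arr f := by simp [G.s_arr, F.s_arr]
  t_arr f := by simp [G.t_arr, F.t_arr]
  arr_i x := by simp [G.arr_i, F.arr_i]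
  arr_comp f g h := by simp [G.arr_comp, F.arr_comp]
  F₂ := LinearMap.mk₂ K
    (fun x y => L''.V.comp (G.F₂ (F.obj x) (F.obj y)) (G.arr (F.F₂ x y))
      (by rw [G.t_F₂, G.s_arr, F.s_F₂]))
    (fun x x' y => by simp only [TwoVectorSpace.comp_eq, map_add, LinearMap.add_apply]; abel)
    (fun c x y => by
      simp only [TwoVectorSpace.comp_eq, map_smul, LinearMap.smul_apply, smul_sub, smul_add])
    (fun x y y' => by simp only [TwoVectorSpace.comp_eq, map_add]; abel)
    (fun c x y => by simp only [TwoVectorSpace.comp_eq, map_smul, smul_sub, smul_add])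
  s_F₂ x y := by
    simp only [LinearMap.mk₂_apply, TwoVectorSpace.s_comp, LinearMap.comp_apply, G.s_F₂]
  t_F₂ x y := by
    simp only [LinearMap.mk₂_apply, TwoVectorSpace.t_comp, LinearMap.comp_apply, G.t_arr, F.t_F₂]
  F₂_natural f g := by
    have h1 := G.F₂_natural (F.arr f) (F.arr g)
    have h2 := congrArg G.arr (F.F₂_natural f g)
    simp only [TwoVectorSpace.comp_eq, LinearMap.mk₂_apply, LinearMap.comp_apply, map_add,
      map_sub, L'.t_br, L''.t_br, F.t_arr, F.s_arr, F.t_F₂, G.t_F₂, G.t_arr, G.arr_i, L''.V.t_i] at h1 h2 ⊢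
    grind
  F₂_skew x y := by
    simp only [LinearMap.mk₂_apply, TwoVectorSpace.comp_eq]
    rw [G.F₂_skew, F.F₂_skew]
    simp only [map_neg]
    abel
  F₂_jacobiator x y z := by
    have h1 := G.F₂_jacobiator (F.obj x) (F.obj y) (F.obj z)
    have h2 := congrArg G.arr (F.F₂_jacobiator x y z)
    have h3 := G.F₂_natural (L'.V.i (F.obj x)) (F.F₂ y z)
    have h4 := G.F₂_natural (F.F₂ x z) (L'.V.i (F.obj y))
    have h5 := G.F₂_natural (F.F₂ x y) (L'.V.i (F.obj z))
    simp only [TwoVectorSpace.comp_eq, LinearMap.mk₂_apply, LinearMap.comp_apply, map_add,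
      map_sub, LinearMap.add_apply, LinearMap.sub_apply, L'.t_br, L''.t_br, F.t_F₂, F.s_F₂,
      G.t_F₂, G.t_arr, G.arr_i, L''.V.t_i, L'.V.t_i, L'.V.s_i, L'.t_J, L''.t_J, L''.br_i]
      at h1 h2 h3 h4 h5 ⊢
    grind

/-- A `2`-homomorphism `θ : F ⇒ G`: a linear natural transformation between the underlying
linear functors compatible with `F₂` and `G₂`. -/
structure TwoHom {L : SemistrictLieTwoAlgebra.{v, u₁} K}
    {L' : SemistrictLieTwoAlgebra.{v, u₂} K} (F G : Hom L L') where
  θ : L.V.Obj →ₗ[K] L'.V.Arr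
  s_θ : ∀ x, L'.V.s (θ x) = F.obj x
  t_θ : ∀ x, L'.V.t (θ x) = G.obj x
  θ_natural : ∀ f : L.V.Arr,
    L'.V.comp (F.arr f) (θ (L.V.t f)) (by rw [F.t_arr, s_θ]) =
      L'.V.comp (θ (L.V.s f)) (G.arr f) (by rw [t_θ, G.s_arr])
  θ_br : ∀ x y,
    L'.V.comp (F.F₂ x y) (θ (L.br₀ x y)) (by rw [F.t_F₂, s_θ]) =
      L'.V.comp (L'.br₁ (θ x) (θ y)) (G.F₂ x y) (by rw [L'.t_br, t_θ, t_θ, G.s_F₂])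

/-- An invertible `2`-homomorphism `F ⇒ G` (with respect to vertical composition). -/
structure TwoIso {L : SemistrictLieTwoAlgebra.{v, u₁} K}
    {L' : SemistrictLieTwoAlgebra.{v, u₂} K} (F G : Hom L L') where
  hom : TwoHom F G
  inv : TwoHom G F
  hom_inv : ∀ x, L'.V.comp (hom.θ x) (inv.θ x) (by rw [hom.t_θ, inv.s_θ]) = L'.V.i (F.obj x)
  inv_hom : ∀ x, L'.V.comp (inv.θ x) (hom.θ x) (by rw [inv.t_θ, hom.s_θ]) = L'.V.i (G.obj x)

/-- Equivalence of semi-strict Lie `2`-algebras, as objects of the `2`-category of semi-strict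
Lie `2`-algebras, homomorphisms and `2`-homomorphisms. -/
def Equivalent (L : SemistrictLieTwoAlgebra.{v, u₁} K)
    (L' : SemistrictLieTwoAlgebra.{v, u₂} K) : Prop :=
  ∃ (F : Hom L L') (G : Hom L' L),
    Nonempty (TwoIso (F.comp G) (Hom.id L)) ∧ Nonempty (TwoIso (G.comp F) (Hom.id L'))

end SemistrictLieTwoAlgebra

/-! ## Crossed modules of Lie algebras and their outer action -/

/-- A crossed module of Lie algebras `μ : h → g`, with an action of `g` on `h` by derivations. -/
structure CrossedModule (K : Type v) [Field K] where
  h : Type u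
  g : Type u
  [hLieRing : LieRing h]
  [hLieAlgebra : LieAlgebra K h]
  [gLieRing : LieRing g]
  [gLieAlgebra : LieAlgebra K g]
  μ : h →ₗ⁅K⁆ g
  act : g →ₗ⁅K⁆ LieDerivation K h h
  μ_act : ∀ (x : g) (a : h), μ (act x a) = ⁅x, μ a⁆
  act_μ : ∀ a b : h, act (μ a) b = ⁅a, b⁆

attribute [instance] CrossedModule.hLieRing CrossedModule.hLieAlgebra CrossedModule.gLieRing
  CrossedModule.gLieAlgebra

namespace CrossedModule

variable {K : Type v} [Field K] (X : CrossedModule.{v, u} K)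

/-- The image `μ(h)`, which is an ideal of `g`. -/
def imageIdeal : LieIdeal K X.g where
  toSubmodule := LinearMap.range (X.μ : X.h →ₗ[K] X.g)
  lie_mem := by
    rintro x _ ⟨a, rfl⟩
    exact ⟨X.act x a, X.μ_act x a⟩

/-- The cokernel `g / μ(h)`. -/
abbrev Coker : Type u := X.g ⧸ X.imageIdeal

/-- The projection `g → g / μ(h)`. -/
abbrev toCoker (x : X.g) : X.Coker := LieSubmodule.Quotient.mk x

/-- The Lie algebra of outer derivations of `h`: all derivations modulo inner derivations. -/
abbrev Out : Type u := LieDerivation K X.h X.h ⧸ (LieDerivation.ad K X.h).idealRange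

/-- The projection from derivations to outer derivations. -/
abbrev toOut (D : LieDerivation K X.h X.h) : X.Out := LieSubmodule.Quotient.mk D

/-- The outer action `g / μ(h) → out(h)`: the class of `x` is sent to the class of the
derivation by which `x` acts. -/
def outerAction : X.Coker →ₗ⁅K⁆ X.Out where
  toLinearMap := Submodule.mapQ X.imageIdeal.toSubmodule
    (LieDerivation.ad K X.h).idealRange.toSubmodule
    (X.act : X.g →ₗ[K] LieDerivation K X.h X.h) (by
      rintro _ ⟨a, rfl⟩
      refine LieDerivation.mem_ad_idealRange_iff.2 ⟨a, ?_⟩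
      ext b
      simp [X.act_μ])
  map_lie' := by
    intro x y
    induction x using Submodule.Quotient.induction_on with | _ x
    induction y using Submodule.Quotient.induction_on with | _ y
    exact congrArg X.toOut (X.act.map_lie x y)

/-- The action of `g` on `h` makes `h` a module over the Lie algebra `g / μ(h)`. -/
def IsCokerModule : Prop :=
  ∃ (_ : LieRingModule X.Coker X.h) (_ : LieModule K X.Coker X.h),
    ∀ (x : X.g) (a : X.h), ⁅X.toCoker x, a⁆ = X.act x a

/-- The outer action is a genuine action: it lifts to a homomorphism of Lie algebras
`σ : g / μ(h) → der(h)`, by which the class of `x` acts on `h` as `x` does. -/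
def OuterActionIsGenuine : Prop :=
  ∃ σ : X.Coker →ₗ⁅K⁆ LieDerivation K X.h X.h,
    (∀ x : X.Coker, X.toOut (σ x) = X.outerAction x) ∧ ∀ x : X.g, σ (X.toCoker x) = X.act x

end CrossedModule

/-! ## Strict Lie 2-algebras -/

/-- The Lie algebra of composable pairs, for Lie algebra homomorphisms `s` and `t`. -/
def composablePairs {K : Type v} [Field K] {A : Type u} {O : Type u} [LieRing A]
    [LieAlgebra K A] [LieRing O] [LieAlgebra K O] (s t : A →ₗ⁅K⁆ O) : LieSubalgebra K (A × A) where
  toSubmodule := LinearMap.eqLocus ((t : A →ₗ[K] O) ∘ₗ LinearMap.fst K A A)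
    ((s : A →ₗ[K] O) ∘ₗ LinearMap.snd K A A)
  lie_mem' := by
    rintro ⟨f, g⟩ ⟨f', g'⟩ h h'
    have h₁ : t f = s g := h
    have h₂ : t f' = s g' := h'
    change t ⁅f, f'⁆ = s ⁅g, g'⁆
    rw [LieHom.map_lie, LieHom.map_lie, h₁, h₂]

/-- A strict Lie `2`-algebra: a category object in the category of Lie algebras over `K`. -/
structure StrictLieTwoAlgebra (K : Type v) [Field K] where
  Obj : Type u
  Arr : Type u
  [objLieRing : LieRing Obj]
  [objLieAlgebra : LieAlgebra K Obj]
  [arrLieRing : LieRing Arr]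
  [arrLieAlgebra : LieAlgebra K Arr]
  /-- source -/
  s : Arr →ₗ⁅K⁆ Obj
  /-- target -/
  t : Arr →ₗ⁅K⁆ Obj
  /-- object inclusion (identity arrows) -/
  i : Obj →ₗ⁅K⁆ Arr
  /-- composition, in diagrammatic order -/
  m : ↥(composablePairs s t) →ₗ⁅K⁆ Arr
  s_i : ∀ x, s (i x) = x
  t_i : ∀ x, t (i x) = x
  s_m : ∀ p, s (m p) = s p.1.1
  t_m : ∀ p, t (m p) = t p.1.2
  i_m : ∀ f, m ⟨(i (s f), f), t_i (s f)⟩ = f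
  m_i : ∀ f, m ⟨(f, i (t f)), (s_i (t f)).symm⟩ = f
  m_assoc : ∀ (f g h : Arr) (hfg : t f = s g) (hgh : t g = s h),
    m ⟨(m ⟨(f, g), hfg⟩, h), (t_m _).trans hgh⟩ =
      m ⟨(f, m ⟨(g, h), hgh⟩), hfg.trans (s_m ⟨(g, h), hgh⟩).symm⟩

attribute [instance] StrictLieTwoAlgebra.objLieRing StrictLieTwoAlgebra.objLieAlgebra
  StrictLieTwoAlgebra.arrLieRing StrictLieTwoAlgebra.arrLieAlgebra

namespace StrictLieTwoAlgebra

variable {K : Type v} [Field K] (S : StrictLieTwoAlgebra.{v, u} K)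

/-- The underlying `2`-vector space. -/
abbrev toTwoVectorSpace : TwoVectorSpace.{v, u} K where
  Obj := S.Obj
  Arr := S.Arr
  s := S.s
  t := S.t
  i := S.i
  m := (S.m : ↥(composablePairs S.s S.t) →ₗ[K] S.Arr)
  s_i := S.s_i
  t_i := S.t_i
  s_m := S.s_m
  t_m := S.t_m
  i_m := S.i_m
  m_i := S.m_i
  m_assoc := S.m_assoc

/-- The Lie bracket of objects as a bilinear map. -/
def brObj : S.Obj →ₗ[K] S.Obj →ₗ[K] S.Obj := LinearMap.mk₂ K (fun x y => ⁅x, y⁆)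
  (fun _ _ _ => add_lie _ _ _) (fun _ _ _ => smul_lie _ _ _) (fun _ _ _ => lie_add _ _ _)
  (fun _ _ _ => lie_smul _ _ _)

/-- The Lie bracket of arrows as a bilinear map. -/
def brArr : S.Arr →ₗ[K] S.Arr →ₗ[K] S.Arr := LinearMap.mk₂ K (fun f g => ⁅f, g⁆)
  (fun _ _ _ => add_lie _ _ _) (fun _ _ _ => smul_lie _ _ _) (fun _ _ _ => lie_add _ _ _)
  (fun _ _ _ => lie_smul _ _ _)

/-- The Jacobi identity in the form used for the Jacobiator. -/
theorem lie_lie_right_eq {A : Type u} [LieRing A] (x y z : A) :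
    ⁅⁅x, y⁆, z⁆ = ⁅x, ⁅y, z⁆⁆ + ⁅⁅x, z⁆, y⁆ := by
  rw [lie_lie, ← lie_skew y ⁅x, z⁆]
  abel

/-- A strict Lie `2`-algebra as a `2`-vector space with a functorial bracket and a Jacobiator: the
bracket is given by the Lie brackets of objects and arrows, and the Jacobiator consists of
identity arrows. -/
def toBracketTwoVectorSpace : BracketTwoVectorSpace.{v, u} K where
  V := S.toTwoVectorSpace
  br₀ := S.brObj
  br₁ := S.brArr
  br₀_skew (x y : S.Obj) := (lie_skew x y).symm
  br₁_skew (f g : S.Arr) := (lie_skew f g).symm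
  s_br (f g : S.Arr) := S.s.map_lie f g
  t_br (f g : S.Arr) := S.t.map_lie f g
  br_i (x y : S.Obj) := (S.i.map_lie x y).symm
  br_comp (f f' g g' : S.Arr) hf hg := (S.m.map_lie ⟨(f, f'), hf⟩ ⟨(g, g'), hg⟩).symm
  J := S.brObj.compr₂ (S.brObj.compr₂ (S.i : S.Obj →ₗ[K] S.Arr))
  s_J (x y z : S.Obj) := S.s_i ⁅⁅x, y⁆, z⁆
  t_J (x y z : S.Obj) := (S.t_i ⁅⁅x, y⁆, z⁆).trans (lie_lie_right_eq x y z)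
  J_natural (f g h : S.Arr) := by
    rw [TwoVectorSpace.comp_eq, TwoVectorSpace.comp_eq]
    change ⁅⁅f, g⁆, h⁆ + S.i ⁅⁅S.t f, S.t g⁆, S.t h⁆ - S.i (S.t ⁅⁅f, g⁆, h⁆) =
      S.i ⁅⁅S.s f, S.s g⁆, S.s h⁆ + (⁅f, ⁅g, h⁆⁆ + ⁅⁅f, h⁆, g⁆)
        - S.i (S.t (S.i ⁅⁅S.s f, S.s g⁆, S.s h⁆))
    rw [S.t_i, ← lie_lie_right_eq, LieHom.map_lie S.t, LieHom.map_lie S.t]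
    abel
  J_antisymm_left (x y z : S.Obj) := by
    have h (a : S.Obj) : S.toTwoVectorSpace.arrowPart (S.i a) = 0 :=
      (congrArg (fun b => S.i a - S.i b) (S.s_i a)).trans (sub_self _)
    exact (h ⁅⁅y, x⁆, z⁆).trans (neg_eq_zero.2 (h ⁅⁅x, y⁆, z⁆)).symm
  J_antisymm_right (x y z : S.Obj) := by
    have h (a : S.Obj) : S.toTwoVectorSpace.arrowPart (S.i a) = 0 :=
      (congrArg (fun b => S.i a - S.i b) (S.s_i a)).trans (sub_self _)
    exact (h ⁅⁅x, z⁆, y⁆).trans (neg_eq_zero.2 (h ⁅⁅x, y⁆, z⁆)).symm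

/-- A strict Lie `2`-algebra regarded as a semi-strict one. -/
def toSemistrict : SemistrictLieTwoAlgebra.{v, u} K where
  toBracketTwoVectorSpace := S.toBracketTwoVectorSpace
  jacobiator_identity := S.toBracketTwoVectorSpace.jacobiator_identity_of_identities
    (fun _ _ _ => rfl) (fun x y z => lie_lie_right_eq (A := S.Obj) x y z)

/-- The kernels of source and target commute. -/
theorem lie_kernels_eq_zero (a b : S.Arr) (ha : S.s a = 0) (hb : S.t b = 0) : ⁅a, b⁆ = 0 := by
  have h1 : S.t (0 : S.Arr) = S.s a := by rw [map_zero, ha]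
  have h2 : S.t b = S.s (0 : S.Arr) := by rw [map_zero, hb]
  have h := S.m.map_lie ⟨(0, a), h1⟩ ⟨(b, 0), h2⟩
  have e1 : S.m ⟨(0, a), h1⟩ = a := (S.toTwoVectorSpace.comp_eq 0 a h1).trans (by
    change 0 + a - S.i (S.t 0) = a
    simp)
  have e2 : S.m ⟨(b, 0), h2⟩ = b := (S.toTwoVectorSpace.comp_eq b 0 h2).trans (by
    change b + 0 - S.i (S.t b) = b
    simp [hb])
  rw [e1, e2] at h
  rw [← h]
  have h3 : (⁅(⟨(0, a), h1⟩ : composablePairs S.s S.t), ⟨(b, 0), h2⟩⁆ : composablePairs S.s S.t)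
      = 0 := by
    apply Subtype.ext
    change (⁅(0 : S.Arr), b⁆, ⁅a, (0 : S.Arr)⁆) = 0
    simp
  rw [h3, map_zero]

/-- The crossed module of a strict Lie `2`-algebra: `h` is the kernel of the source map, `g` is
the Lie algebra of objects, `μ` is the restriction of the target map, and `x` in `g` acts on `h`
by the bracket with `i x`. -/
def crossedModule : CrossedModule.{v, u} K where
  h := ↥S.s.ker
  g := S.Obj
  μ := S.t.comp S.s.ker.incl
  act :=
    { toFun := fun x =>
        { toFun := fun a => ⟨⁅S.i x, (a : S.Arr)⁆, lie_mem_right K S.Arr S.s.ker _ _ a.2⟩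
          map_add' := fun a b => by ext; simp
          map_smul' := fun c a => by ext; simp
          leibniz' := fun a b => by
            apply Subtype.ext
            change ⁅S.i x, ⁅(a : S.Arr), (b : S.Arr)⁆⁆ =
              ⁅(a : S.Arr), ⁅S.i x, (b : S.Arr)⁆⁆ - ⁅(b : S.Arr), ⁅S.i x, (a : S.Arr)⁆⁆
            rw [leibniz_lie, ← lie_skew (b : S.Arr)]
            abel }
      map_add' := fun x y => by
        ext a
        change ⁅S.i (x + y), (a : S.Arr)⁆ = ⁅S.i x, (a : S.Arr)⁆ + ⁅S.i y, (a : S.Arr)⁆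
        rw [map_add, add_lie]
      map_smul' := fun c x => by
        ext a
        change ⁅S.i (c • x), (a : S.Arr)⁆ = c • ⁅S.i x, (a : S.Arr)⁆
        rw [map_smul, smul_lie]
      map_lie' := fun {x y} => by
        ext a
        change ⁅S.i ⁅x, y⁆, (a : S.Arr)⁆ =
          ⁅S.i x, ⁅S.i y, (a : S.Arr)⁆⁆ - ⁅S.i y, ⁅S.i x, (a : S.Arr)⁆⁆
        rw [LieHom.map_lie, lie_lie] }
  μ_act x a := by
    change S.t ⁅S.i x, (a : S.Arr)⁆ = ⁅x, S.t (a : S.Arr)⁆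
    rw [LieHom.map_lie, S.t_i]
  act_μ a b := by
    apply Subtype.ext
    change ⁅S.i (S.t (a : S.Arr)), (b : S.Arr)⁆ = ⁅(a : S.Arr), (b : S.Arr)⁆
    have h := S.lie_kernels_eq_zero (b : S.Arr) (S.i (S.t (a : S.Arr)) - (a : S.Arr))
      (S.s.mem_ker.1 b.2) (by rw [map_sub, S.t_i, sub_self])
    rw [lie_sub, sub_eq_zero] at h
    rw [← lie_skew, h, lie_skew]

end StrictLieTwoAlgebra

end LieTwo

/-! Up to equivalence a semi-strict Lie 2-algebra is skeletal, that is, a Lie algebra `g`, a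
`g`-module `V` and an alternating 3-cocycle `om` with values in `V`. Here `g` is the space of
isomorphism classes of objects, `V` is the space of automorphisms of `0`, and `om` measures the
Jacobiator once brackets of representatives have been moved to representatives of brackets
(`SkeletonData.loop_cocycle`).

To make this strict, embed `V` as the constants in a `g`-module `F` in which `om` becomes a
coboundary, `om = d P`. Modulo constants `P` is a 2-cocycle, so `-P` defines an extension of `g` by
the abelian Lie algebra `F / V`. The crossed module `F → (extension of g by F / V)` has abelian
source, cokernel `g` and kernel `V`. The arrows `P x y` make the inclusion of the skeletal model a
homomorphism: its compatibility with the Jacobiators is the equation `om = d P`. Once `h` is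
abelian, the remaining properties are formal: `μ(h)` acts by inner derivations, hence by zero.

For `F` take the formal functions with values in `V` on the formal group of `g`, in exponential
coordinates. An element of `g` acts by its left invariant vector field together with its action on
the values. This is the covariant derivative of the flat connection given by the Maurer–Cartan form,
and cochains of `g` with values in `F` correspond to differential forms. The primitive comes from
the Poincaré lemma with radial homotopy: contract with the Euler field and invert its covariant Lie
derivative, which on `k`-forms is `N + k + coord · _` with `N` the Euler operator. In characteristic
`0` the operator `N + k` is invertible for `k ≥ 1`, and the last term raises the order, so a Neumann
series inverts the sum. Uniqueness of the solution of such a radial equation yields the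
Maurer–Cartan equation (`mc_equation`) and the equation for the potential (`pot_equation`).

Finally, a fully faithful and essentially surjective homomorphism has a weak inverse, because over a
field all choices can be made linearly (`Hom.IsWeakEquiv.exists_inverse`). -/

namespace LieTwo

/-! ## Formal functions on a vector space

A formal function on `g` with values in `W` is given by its Taylor coefficients at the origin,
which are symmetric multilinear maps, and are indexed here by the finite multisets of vectors. -/

/-- Formal functions on `g` with values in `W`: functions of finite multisets of vectors of `g`
that are linear in each entry. -/
def FormalFun (K : Type*) [Field K] (g W : Type*) [AddCommGroup g] [Module K g]
    [AddCommGroup W] [Module K W] : Submodule K (Multiset g → W) where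
  -- Multisets are unordered, so symmetry is built in and linearity in the added entry is linearity
  -- in every entry.
  carrier := {φ | ∀ m, IsLinearMap K fun z => φ (z ::ₘ m)}
  add_mem' {φ ψ} hφ hψ m :=
    ⟨fun x y => by simp only [Pi.add_apply, (hφ m).map_add, (hψ m).map_add]; abel,
      fun c x => by simp only [Pi.add_apply, (hφ m).map_smul, (hψ m).map_smul, smul_add]⟩
  zero_mem' m := ⟨fun x y => by simp, fun c x => by simp⟩
  smul_mem' c φ hφ m :=
    ⟨fun x y => by simp only [Pi.smul_apply, (hφ m).map_add, smul_add],
      fun d x => by simp only [Pi.smul_apply, (hφ m).map_smul, smul_comm c d]⟩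

namespace FormalFun

variable {K : Type*} [Field K] {g : Type*} [AddCommGroup g] [Module K g]
variable {W W₁ W₂ W₃ W₄ W₅ W₆ : Type*} [AddCommGroup W] [Module K W] [AddCommGroup W₁] [Module K W₁]
  [AddCommGroup W₂] [Module K W₂] [AddCommGroup W₃] [Module K W₃] [AddCommGroup W₄] [Module K W₄]
  [AddCommGroup W₅] [Module K W₅] [AddCommGroup W₆] [Module K W₆]

instance : CoeFun (FormalFun K g W) fun _ => Multiset g → W := ⟨Subtype.val⟩

@[ext] theorem ext {φ ψ : FormalFun K g W} (h : ∀ m, φ m = ψ m) : φ = ψ := Subtype.ext (funext h)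

@[simp] theorem add_at (φ ψ : FormalFun K g W) (m) : (φ + ψ) m = φ m + ψ m := rfl
@[simp] theorem sub_at (φ ψ : FormalFun K g W) (m) : (φ - ψ) m = φ m - ψ m := rfl
@[simp] theorem neg_at (φ : FormalFun K g W) (m) : (-φ) m = -φ m := rfl
@[simp] theorem smul_at (c : K) (φ : FormalFun K g W) (m) : (c • φ) m = c • φ m := rfl
@[simp] theorem zero_at (m) : (0 : FormalFun K g W) m = 0 := rfl

/-- The derivative in the direction of a constant vector. -/
def D : g →ₗ[K] FormalFun K g W →ₗ[K] FormalFun K g W :=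
  LinearMap.mk₂ K
    (fun z φ => ⟨fun m => φ (z ::ₘ m), fun m =>
      ⟨fun x y => by simp only [Multiset.cons_swap z, (φ.2 _).map_add],
        fun c x => by simp only [Multiset.cons_swap z, (φ.2 _).map_smul]⟩⟩)
    (fun x y φ => ext fun m => (φ.2 m).map_add x y)
    (fun c x φ => ext fun m => (φ.2 m).map_smul c x)
    (fun x φ ψ => rfl) (fun c x φ => rfl)

@[simp] theorem D_apply (z : g) (φ : FormalFun K g W) (m) : D z φ m = φ (z ::ₘ m) := rfl

theorem D_comm (y z : g) (φ : FormalFun K g W) : D y (D z φ) = D z (D y φ) :=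
  ext fun m => by simp [Multiset.cons_swap y z]

/-- The constant functions. -/
noncomputable def const : W →ₗ[K] FormalFun K g W where
  toFun w := ⟨fun m => by classical exact if m = 0 then w else 0, fun m =>
    ⟨fun x y => by simp, fun c x => by simp⟩⟩
  map_add' x y := ext fun m => by by_cases h : m = 0 <;> simp [h]
  map_smul' c x := ext fun m => by by_cases h : m = 0 <;> simp [h]

@[simp] theorem const_apply_zero (w : W) : (const w : FormalFun K g W) 0 = w := by
  simp [const]

@[simp] theorem const_apply_cons (w : W) (z m) : (const w : FormalFun K g W) (z ::ₘ m) = 0 := by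
  simp [const]

@[simp] theorem D_const (z : g) (w : W) : D z (const w : FormalFun K g W) = 0 :=
  ext fun m => by simp

/-- The identity function of `g`. -/
def coord : FormalFun K g g :=
  -- The sum of a one-element multiset is its element.
  ⟨fun m => if m.card = 1 then m.sum else 0, fun m => by
    by_cases h : m.card = 0
    · obtain rfl := Multiset.card_eq_zero.1 h
      exact ⟨fun x y => by simp, fun c x => by simp⟩
    · exact ⟨fun x y => by simp [h], fun c x => by simp [h]⟩⟩

@[simp] theorem coord_apply_zero : (coord : FormalFun K g g) 0 = 0 := by simp [coord]

@[simp] theorem D_coord (z : g) : D z (coord : FormalFun K g g) = const z :=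
  ext fun m => by
    by_cases h : m = 0
    · subst h; simp [coord]
    · simp [coord, const, h]

/-- The Euler operator. -/
def euler : FormalFun K g W →ₗ[K] FormalFun K g W where
  toFun φ := ⟨fun m => (m.card : K) • φ m, fun m =>
    ⟨fun x y => by simp only [Multiset.card_cons, (φ.2 m).map_add, smul_add],
      fun c x => by simp only [Multiset.card_cons, (φ.2 m).map_smul, smul_comm c]⟩⟩
  map_add' φ ψ := ext fun m => by simp
  map_smul' c φ := ext fun m => by simp [smul_comm c]

theorem euler_apply (φ : FormalFun K g W) (m) : euler φ m = (m.card : K) • φ m := rfl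

@[simp] theorem euler_apply_zero (φ : FormalFun K g W) : euler φ 0 = 0 := by simp [euler_apply]

theorem D_euler (z : g) (φ : FormalFun K g W) : D z (euler φ) = euler (D z φ) + D z φ :=
  ext fun m => by simp [euler_apply, add_smul]

theorem euler_D (z : g) (φ : FormalFun K g W) : euler (D z φ) = D z (euler φ) - D z φ := by
  rw [D_euler]; abel

/-- The Cauchy product of Taylor coefficients, as a function of multisets. -/
def convFun (b : W₁ →ₗ[K] W₂ →ₗ[K] W₃) (φ : Multiset g → W₁) (ψ : Multiset g → W₂)
    (m : Multiset g) : W₃ :=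
  (m.antidiagonal.map fun p => b (φ p.1) (ψ p.2)).sum

-- The Leibniz rule: `z` goes to one of the two factors. The antidiagonal counts splittings with
-- multiplicity, so no binomial coefficients are needed.
omit [AddCommGroup g] [Module K g] in
theorem convFun_cons (b : W₁ →ₗ[K] W₂ →ₗ[K] W₃) (φ : Multiset g → W₁) (ψ : Multiset g → W₂)
    (z : g) (m : Multiset g) :
    convFun b φ ψ (z ::ₘ m) =
      convFun b (fun m => φ (z ::ₘ m)) ψ m + convFun b φ (fun m => ψ (z ::ₘ m)) m := by
  simp [convFun, Multiset.antidiagonal_cons, Multiset.map_map, add_comm]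

/-- The product of formal functions, with respect to a bilinear map. -/
def conv (b : W₁ →ₗ[K] W₂ →ₗ[K] W₃) :
    FormalFun K g W₁ →ₗ[K] FormalFun K g W₂ →ₗ[K] FormalFun K g W₃ :=
  LinearMap.mk₂ K
    (fun φ ψ => ⟨convFun b φ ψ, fun m =>
      ⟨fun x y => by
          simp only [convFun_cons, (φ.2 _).map_add, (ψ.2 _).map_add]
          simp only [convFun, map_add, LinearMap.add_apply, Multiset.sum_map_add]
          abel,
        fun c x => by
          simp only [convFun_cons, (φ.2 _).map_smul, (ψ.2 _).map_smul]
          simp only [convFun, map_smul, LinearMap.smul_apply, Multiset.smul_sum,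
            Multiset.map_map, smul_add, Function.comp_def]⟩⟩)
    (fun φ φ' ψ => ext fun m => by simp [convFun])
    (fun c φ ψ => ext fun m => by simp [convFun, Multiset.smul_sum, Multiset.map_map])
    (fun φ ψ ψ' => ext fun m => by simp [convFun])
    (fun c φ ψ => ext fun m => by simp [convFun, Multiset.smul_sum, Multiset.map_map])

theorem conv_apply (b : W₁ →ₗ[K] W₂ →ₗ[K] W₃) (φ : FormalFun K g W₁) (ψ : FormalFun K g W₂)
    (m : Multiset g) :
    conv b φ ψ m = (m.antidiagonal.map fun p => b (φ p.1) (ψ p.2)).sum := rfl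

@[simp] theorem conv_apply_zero (b : W₁ →ₗ[K] W₂ →ₗ[K] W₃) (φ : FormalFun K g W₁)
    (ψ : FormalFun K g W₂) : conv b φ ψ 0 = b (φ 0) (ψ 0) := by
  simp [conv_apply]

theorem D_conv (b : W₁ →ₗ[K] W₂ →ₗ[K] W₃) (φ : FormalFun K g W₁) (ψ : FormalFun K g W₂) (z : g) :
    D z (conv b φ ψ) = conv b (D z φ) ψ + conv b φ (D z ψ) :=
  ext fun m => convFun_cons b φ ψ z m

/-- The engine of the inductions on multisets: an identity valid for all formal functions and
compatible with `D z` need only be checked at the empty multiset. -/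
theorem apply_cons (φ : FormalFun K g W) (z : g) (m : Multiset g) : φ (z ::ₘ m) = D z φ m := rfl

theorem euler_conv (b : W₁ →ₗ[K] W₂ →ₗ[K] W₃) (φ : FormalFun K g W₁) (ψ : FormalFun K g W₂) :
    euler (conv b φ ψ) = conv b (euler φ) ψ + conv b φ (euler ψ) := by
  ext m
  induction m using Multiset.induction generalizing φ ψ with
  | empty => simp
  | cons z m ih =>
    simp only [add_at] at ih
    simp only [apply_cons, map_add, D_conv, D_euler, LinearMap.add_apply, add_at, ih]
    abel

theorem conv_const_const (b : W₁ →ₗ[K] W₂ →ₗ[K] W₃) (v : W₁) (w : W₂) :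
    conv b (const v : FormalFun K g W₁) (const w) = const (b v w) := by
  ext m
  induction m using Multiset.induction with
  | empty => simp
  | cons z m ih => simp [apply_cons, D_conv]

theorem conv_flip (b : W₁ →ₗ[K] W₂ →ₗ[K] W₃) (φ : FormalFun K g W₁) (ψ : FormalFun K g W₂) :
    conv b.flip ψ φ = conv b φ ψ := by
  ext m
  induction m using Multiset.induction generalizing φ ψ with
  | empty => simp
  | cons z m ih => simp only [apply_cons, D_conv, add_at, ih]; abel

theorem conv_neg_left (b : W₁ →ₗ[K] W₂ →ₗ[K] W₃) (φ : FormalFun K g W₁) (ψ : FormalFun K g W₂) :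
    conv (-b) φ ψ = -conv b φ ψ := by
  ext m
  induction m using Multiset.induction generalizing φ ψ with
  | empty => simp
  | cons z m ih => simp only [apply_cons, D_conv, add_at, ih, neg_at]; abel

theorem conv_skew {b : W₁ →ₗ[K] W₁ →ₗ[K] W₃} (hb : ∀ x y, b x y = -b y x)
    (φ ψ : FormalFun K g W₁) : conv b φ ψ = -conv b ψ φ := by
  have h : -b.flip = b := by
    ext x y
    simp [hb x y]
  rw [← conv_flip b ψ φ, ← conv_neg_left, h]

/-! ### Differential forms and vector fields -/

/-- Evaluation of a form on a formal function. -/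
abbrev eval (F : FormalFun K g (W₁ →ₗ[K] W₂)) (ψ : FormalFun K g W₁) : FormalFun K g W₂ :=
  conv LinearMap.id F ψ

/-- The total derivative. -/
def grad : FormalFun K g W →ₗ[K] FormalFun K g (g →ₗ[K] W) where
  toFun φ := ⟨fun m => (φ.2 m).mk', fun m =>
    ⟨fun x y => LinearMap.ext fun z => by
        simp only [IsLinearMap.mk'_apply, LinearMap.add_apply, Multiset.cons_swap z,
          (φ.2 _).map_add],
      fun c x => LinearMap.ext fun z => by
        simp only [IsLinearMap.mk'_apply, LinearMap.smul_apply, Multiset.cons_swap z,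
          (φ.2 _).map_smul]⟩⟩
  map_add' φ ψ := rfl
  map_smul' c φ := rfl

@[simp] theorem grad_apply (φ : FormalFun K g W) (m z) : grad φ m z = φ (z ::ₘ m) := rfl

theorem D_grad (z : g) (φ : FormalFun K g W) : D z (grad φ) = grad (D z φ) :=
  ext fun m => LinearMap.ext fun y => by simp [Multiset.cons_swap y z]

/-- The derivative along a vector field. -/
def deriv (ψ : FormalFun K g g) : FormalFun K g W →ₗ[K] FormalFun K g W :=
  (conv LinearMap.id).flip ψ ∘ₗ grad

theorem deriv_eq (ψ : FormalFun K g g) (φ : FormalFun K g W) : deriv ψ φ = eval (grad φ) ψ := rfl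

theorem deriv_apply_zero (ψ : FormalFun K g g) (φ : FormalFun K g W) :
    deriv ψ φ 0 = D (ψ 0) φ 0 := by
  simp [deriv_eq]

theorem deriv_add_left (ψ ψ' : FormalFun K g g) (φ : FormalFun K g W) :
    deriv (ψ + ψ') φ = deriv ψ φ + deriv ψ' φ := by simp [deriv_eq]

theorem deriv_sub_left (ψ ψ' : FormalFun K g g) (φ : FormalFun K g W) :
    deriv (ψ - ψ') φ = deriv ψ φ - deriv ψ' φ := by simp [deriv_eq]

theorem deriv_zero_left (φ : FormalFun K g W) : deriv 0 φ = 0 := by simp [deriv_eq]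

theorem deriv_smul_left (c : K) (ψ : FormalFun K g g) (φ : FormalFun K g W) :
    deriv (c • ψ) φ = c • deriv ψ φ := by simp [deriv_eq]

theorem D_deriv (z : g) (ψ : FormalFun K g g) (φ : FormalFun K g W) :
    D z (deriv ψ φ) = deriv (D z ψ) φ + deriv ψ (D z φ) := by
  simp only [deriv_eq, D_conv, D_grad]; abel

theorem deriv_const_left (z : g) (φ : FormalFun K g W) : deriv (const z) φ = D z φ := by
  ext m
  induction m using Multiset.induction generalizing φ with
  | empty => simp [deriv_apply_zero]
  | cons y m ih =>
    rw [apply_cons, D_deriv, D_const, deriv_zero_left, zero_add, ih, apply_cons, D_comm]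

@[simp] theorem deriv_const_right (ψ : FormalFun K g g) (w : W) : deriv ψ (const w) = 0 := by
  have : grad (const w : FormalFun K g W) = 0 := ext fun m => LinearMap.ext fun z => by simp
  rw [deriv_eq, this, eval, map_zero, LinearMap.zero_apply]

theorem deriv_conv (b : W₁ →ₗ[K] W₂ →ₗ[K] W₃) (χ : FormalFun K g g) (φ : FormalFun K g W₁)
    (ψ : FormalFun K g W₂) :
    deriv χ (conv b φ ψ) = conv b (deriv χ φ) ψ + conv b φ (deriv χ ψ) := by
  ext m
  induction m using Multiset.induction generalizing χ φ ψ with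
  | empty => simp [deriv_apply_zero, D_conv]
  | cons z m ih =>
    simp only [add_at] at ih
    simp only [apply_cons, D_deriv, D_conv, map_add, LinearMap.add_apply, add_at, ih]
    abel

/-- The Lie bracket of vector fields acts as the commutator. -/
theorem deriv_deriv_sub (ψ χ : FormalFun K g g) (φ : FormalFun K g W) :
    deriv ψ (deriv χ φ) - deriv χ (deriv ψ φ) = deriv (deriv ψ χ - deriv χ ψ) φ := by
  ext m
  induction m using Multiset.induction generalizing ψ χ φ with
  | empty =>
    simp only [sub_at, deriv_apply_zero, D_deriv, add_at, deriv_sub_left, D_comm (ψ 0)]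
    abel
  | cons z m ih =>
    simp only [sub_at, deriv_sub_left] at ih
    simp only [apply_cons, D_deriv, deriv_sub_left, deriv_add_left, map_add, add_at,
      sub_at]
    have h₁ := ih (D z ψ) χ φ
    have h₂ := ih ψ (D z χ) φ
    have h₃ := ih ψ χ (D z φ)
    grind

end FormalFun
end LieTwo

namespace LieTwo
namespace FormalFun

variable {K : Type*} [Field K] {g : Type*} [AddCommGroup g] [Module K g]
variable {W W₁ W₂ W₃ W₄ W₅ W₆ : Type*} [AddCommGroup W] [Module K W] [AddCommGroup W₁] [Module K W₁]
  [AddCommGroup W₂] [Module K W₂] [AddCommGroup W₃] [Module K W₃] [AddCommGroup W₄] [Module K W₄]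
  [AddCommGroup W₅] [Module K W₅] [AddCommGroup W₆] [Module K W₆]

/-! ### Operators that raise the order, and Neumann series -/

/-- `φ` vanishes to order `n` at the origin. -/
def Vanishes (n : ℕ) (φ : FormalFun K g W) : Prop := ∀ m : Multiset g, m.card < n → φ m = 0

theorem vanishes_zero (φ : FormalFun K g W) : Vanishes 0 φ := fun _ h => absurd h (Nat.not_lt_zero _)

/-- `T` raises the order of vanishing at the origin. -/
def Raises (T : FormalFun K g W →ₗ[K] FormalFun K g W₁) : Prop :=
  ∀ n φ, Vanishes n φ → Vanishes (n + 1) (T φ)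

/-- If `φ` is controlled pointwise by `T φ`, each order of vanishing of `φ` forces the next one.
This gives uniqueness for every equation solved by a Neumann series. -/
theorem eq_zero_of_raises {T : FormalFun K g W →ₗ[K] FormalFun K g W₁} (hT : Raises T)
    {φ : FormalFun K g W} (h : ∀ m, T φ m = 0 → φ m = 0) : φ = 0 := by
  have h' : ∀ n, Vanishes n φ := fun n => by
    induction n with
    | zero => exact vanishes_zero φ
    | succ n ih => exact fun m hm => h m (hT n φ ih m hm)
  exact ext fun m => h' _ m (Nat.lt_succ_self _)

theorem vanishes_pow {T : FormalFun K g W →ₗ[K] FormalFun K g W} (hT : Raises T)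
    (φ : FormalFun K g W) (n : ℕ) : Vanishes n ((T ^ n) φ) := by
  induction n with
  | zero => exact vanishes_zero _
  | succ n ih =>
    rw [pow_succ', Module.End.mul_apply]
    exact hT n _ ih

/-- The Neumann series `∑ T ^ k` of an operator that raises the order. -/
def neumann (T : FormalFun K g W →ₗ[K] FormalFun K g W) :
    FormalFun K g W →ₗ[K] FormalFun K g W where
  -- When `T` raises the order, `(T ^ k) φ` vanishes on multisets with fewer than `k` elements, so
  -- the omitted terms are zero.
  toFun φ := ⟨fun m => ∑ k ∈ Finset.range (m.card + 1), (T ^ k) φ m, fun m =>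
    ⟨fun x y => by
        simp only [Multiset.card_cons, (((T ^ _) φ).2 m).map_add, Finset.sum_add_distrib],
      fun c x => by
        simp only [Multiset.card_cons, (((T ^ _) φ).2 m).map_smul, Finset.smul_sum]⟩⟩
  map_add' φ ψ := ext fun m => by simp [Finset.sum_add_distrib]
  map_smul' c φ := ext fun m => by simp [Finset.smul_sum]

theorem neumann_apply (T : FormalFun K g W →ₗ[K] FormalFun K g W) (φ : FormalFun K g W)
    (m : Multiset g) : neumann T φ m = ∑ k ∈ Finset.range (m.card + 1), (T ^ k) φ m := rfl

theorem neumann_eq {T : FormalFun K g W →ₗ[K] FormalFun K g W} (hT : Raises T)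
    (φ : FormalFun K g W) : neumann T φ = φ + T (neumann T φ) := by
  ext m
  set n := m.card
  -- The partial sum with `n` terms is correct to order `n`; applying `T` makes it correct at `m`
  -- itself.
  have h₁ : Vanishes n (neumann T φ - ∑ k ∈ Finset.range n, (T ^ k) φ) := by
    intro m' hm'
    rw [sub_at, neumann_apply, sub_eq_zero]
    have : (∑ k ∈ Finset.range n, (T ^ k) φ : FormalFun K g W) m' =
        ∑ k ∈ Finset.range n, (T ^ k) φ m' := by
      simp
    rw [this]
    refine Finset.sum_subset (Finset.range_mono hm') fun k _ hk => ?_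
    exact vanishes_pow hT φ k m' (by simpa using hk)
  have h₂ := hT _ _ h₁ m (Nat.lt_succ_self _)
  rw [map_sub, sub_at, sub_eq_zero] at h₂
  rw [add_at, h₂, neumann_apply, Finset.sum_range_succ', map_sum]
  simp [pow_succ', add_comm, n]

theorem vanishes_conv (b : W₁ →ₗ[K] W₂ →ₗ[K] W₃) {p q : ℕ} {φ : FormalFun K g W₁}
    {ψ : FormalFun K g W₂} (hφ : Vanishes p φ) (hψ : Vanishes q ψ) :
    Vanishes (p + q) (conv b φ ψ) := by
  intro m hm
  rw [conv_apply]
  refine Multiset.sum_eq_zero fun w hw => ?_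
  obtain ⟨⟨m₁, m₂⟩, hp, rfl⟩ := Multiset.mem_map.1 hw
  have h := congrArg Multiset.card (Multiset.mem_antidiagonal.1 hp)
  rw [Multiset.card_add] at h
  dsimp only at h ⊢
  by_cases h₁ : m₁.card < p
  · rw [hφ _ h₁, map_zero, LinearMap.zero_apply]
  · rw [hψ m₂ (by omega), map_zero]

theorem vanishes_one {φ : FormalFun K g W} (h : φ 0 = 0) : Vanishes 1 φ := fun m hm => by
  rwa [Multiset.card_eq_zero.1 (Nat.lt_one_iff.1 hm)]

theorem raises_conv (b : W₁ →ₗ[K] W₂ →ₗ[K] W₃) {φ : FormalFun K g W₁} (h : φ 0 = 0) :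
    Raises (conv b φ) := fun n ψ hψ => by
  rw [add_comm]
  exact vanishes_conv b (vanishes_one h) hψ

/-- The inverse of the operator `N + c`, for the Euler operator `N` and `c ≥ 1`. -/
def eulerInv (c : ℕ) : FormalFun K g W →ₗ[K] FormalFun K g W where
  toFun φ := ⟨fun m => ((m.card + c : ℕ) : K)⁻¹ • φ m, fun m =>
    ⟨fun x y => by simp only [Multiset.card_cons, (φ.2 m).map_add, smul_add],
      fun a x => by simp only [Multiset.card_cons, (φ.2 m).map_smul, smul_comm a]⟩⟩
  map_add' φ ψ := ext fun m => by simp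
  map_smul' a φ := ext fun m => by simp [smul_comm a]

theorem eulerInv_apply (c : ℕ) (φ : FormalFun K g W) (m) :
    eulerInv c φ m = ((m.card + c : ℕ) : K)⁻¹ • φ m := rfl

theorem Raises.eulerInv_comp {T : FormalFun K g W →ₗ[K] FormalFun K g W₁} (hT : Raises T) (c : ℕ) :
    Raises (eulerInv c ∘ₗ T) := fun n φ hφ m hm => by
  rw [LinearMap.comp_apply, eulerInv_apply, hT n φ hφ m hm, smul_zero]

theorem Raises.neg {T : FormalFun K g W →ₗ[K] FormalFun K g W₁} (hT : Raises T) :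
    Raises (-T) := fun n φ hφ m hm => by
  rw [LinearMap.neg_apply, neg_at, hT n φ hφ m hm, neg_zero]

variable [CharZero K]

theorem euler_eulerInv {c : ℕ} (hc : c ≠ 0) (φ : FormalFun K g W) :
    euler (eulerInv c φ) + (c : K) • eulerInv c φ = φ := by
  ext m
  have h : ((m.card + c : ℕ) : K) ≠ 0 := Nat.cast_ne_zero.2 (by omega)
  rw [add_at, euler_apply, smul_at, ← add_smul, eulerInv_apply, ← Nat.cast_add,
    smul_inv_smul₀ h]

/-- The operator `N + c` multiplies the value at `m` by `m.card + c`, which is nonzero in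
characteristic `0`, so `φ` vanishes wherever `T φ` does. -/
theorem eq_zero_of_euler {T : FormalFun K g W →ₗ[K] FormalFun K g W} (hT : Raises T) {c : ℕ}
    (hc : c ≠ 0) {φ : FormalFun K g W} (h : euler φ + (c : K) • φ = T φ) : φ = 0 := by
  refine eq_zero_of_raises hT fun m hm => ?_
  rw [← h, add_at, euler_apply, smul_at, ← add_smul, ← Nat.cast_add] at hm
  exact (smul_eq_zero.1 hm).resolve_left (Nat.cast_ne_zero.2 (by omega))

/-- The solution `φ` of the equation `(N + c) φ = f - b (coord, φ)`. -/
def radialSolution (b : g →ₗ[K] W →ₗ[K] W) (c : ℕ) : FormalFun K g W →ₗ[K] FormalFun K g W :=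
  neumann (-(eulerInv c ∘ₗ conv b coord)) ∘ₗ eulerInv c

theorem radialSolution_spec (b : g →ₗ[K] W →ₗ[K] W) {c : ℕ} (hc : c ≠ 0) (f : FormalFun K g W) :
    euler (radialSolution b c f) + (c : K) • radialSolution b c f =
      f - conv b coord (radialSolution b c f) := by
  have h := neumann_eq ((raises_conv b (coord_apply_zero (K := K))).eulerInv_comp c).neg
    (eulerInv c f)
  set φ := radialSolution b c f with hφ
  change φ = eulerInv c f + (-(eulerInv c ∘ₗ conv b coord)) φ at h
  have h' : φ = eulerInv c (f - conv b coord φ) := by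
    rw [map_sub]; nth_rw 1 [h]; simp [sub_eq_add_neg]
  rw [h', euler_eulerInv hc, ← h']

/-- The device for proving identities of forms: the defect of the identity is shown to solve the
homogeneous radial equation. -/
theorem radialSolution_unique (b : g →ₗ[K] W →ₗ[K] W) {c : ℕ} (hc : c ≠ 0)
    {φ : FormalFun K g W} (h : euler φ + (c : K) • φ = -conv b coord φ) : φ = 0 :=
  eq_zero_of_euler (T := -conv b coord) (raises_conv b coord_apply_zero).neg hc h

/-! ### Operators given by forms -/

/-- An operator on formal functions is tensorial if it is the evaluation of a form. -/
def Tensorial (T : FormalFun K g W₁ → FormalFun K g W₂) : Prop :=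
  ∃ F : FormalFun K g (W₁ →ₗ[K] W₂), ∀ ψ, T ψ = eval F ψ

omit [CharZero K] in
theorem conv_eval_right (b : W₁ →ₗ[K] W₂ →ₗ[K] W₃) (φ : FormalFun K g W₁)
    (F : FormalFun K g (W →ₗ[K] W₂)) (ψ : FormalFun K g W) :
    conv b φ (eval F ψ) = eval (conv (LinearMap.llcomp K W W₂ W₃ ∘ₗ b) φ F) ψ := by
  ext m
  induction m using Multiset.induction generalizing φ F ψ with
  | empty => simp
  | cons z m ih =>
    simp only [apply_cons, D_conv, map_add, LinearMap.add_apply, add_at, ih]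
    abel

omit [CharZero K] in
theorem eval_const_form (F : FormalFun K g (W →ₗ[K] W₂)) (w : W) (m : Multiset g) :
    eval F (const w) m = F m w := by
  induction m using Multiset.induction generalizing F with
  | empty => simp
  | cons z m ih => simp only [apply_cons, D_conv, D_const, map_zero, add_zero, ih]

omit [CharZero K] in
theorem eval_const_id (ψ : FormalFun K g W) : eval (const LinearMap.id) ψ = ψ := by
  ext m
  induction m using Multiset.induction generalizing ψ with
  | empty => simp
  | cons z m ih =>
    simp only [apply_cons, D_conv, D_const, map_zero, LinearMap.zero_apply, zero_add]
    exact ih _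

namespace Tensorial

omit [CharZero K]

theorem eval_right (F : FormalFun K g (W₁ →ₗ[K] W₂)) :
    Tensorial fun ψ : FormalFun K g W₁ => eval F ψ := ⟨F, fun _ => rfl⟩

theorem add {T U : FormalFun K g W₁ → FormalFun K g W₂} (hT : Tensorial T) (hU : Tensorial U) :
    Tensorial fun ψ => T ψ + U ψ := by
  obtain ⟨F, hF⟩ := hT
  obtain ⟨G, hG⟩ := hU
  exact ⟨F + G, fun ψ => by simp only [eval, hF, hG, map_add, LinearMap.add_apply]⟩

theorem sub {T U : FormalFun K g W₁ → FormalFun K g W₂} (hT : Tensorial T) (hU : Tensorial U) :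
    Tensorial fun ψ => T ψ - U ψ := by
  obtain ⟨F, hF⟩ := hT
  obtain ⟨G, hG⟩ := hU
  exact ⟨F - G, fun ψ => by simp only [eval, hF, hG, map_sub, LinearMap.sub_apply]⟩

theorem conv_right (b : W₂ →ₗ[K] W₃ →ₗ[K] W₄) (φ : FormalFun K g W₂)
    {T : FormalFun K g W₁ → FormalFun K g W₃} (hT : Tensorial T) :
    Tensorial fun ψ => conv b φ (T ψ) := by
  obtain ⟨F, hF⟩ := hT
  exact ⟨_, fun ψ => (congrArg _ (hF ψ)).trans (conv_eval_right b φ F ψ)⟩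

theorem conv_left (b : W₂ →ₗ[K] W₃ →ₗ[K] W₄) {T : FormalFun K g W₁ → FormalFun K g W₂}
    (hT : Tensorial T) (φ : FormalFun K g W₃) : Tensorial fun ψ => conv b (T ψ) φ := by
  simp only [← conv_flip b]
  exact hT.conv_right b.flip φ

/-- The values on constants are the coefficients of the form. Tensoriality replaces linearity over
functions, which would not suffice for infinite-dimensional `g`, where fields need not be finite
combinations of constant ones. -/
theorem eq_zero {T : FormalFun K g W₁ → FormalFun K g W₂} (hT : Tensorial T)
    (h : ∀ w, T (const w) = 0) (ψ : FormalFun K g W₁) : T ψ = 0 := by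
  obtain ⟨F, hF⟩ := hT
  have : F = 0 := ext fun m => LinearMap.ext fun w => by
    rw [← eval_const_form, ← hF, h]; rfl
  rw [hF, this, eval, map_zero, LinearMap.zero_apply]

end Tensorial

end FormalFun
end LieTwo

/-! ### Three-cocycles and the Maurer–Cartan form of the formal group -/

namespace LieTwo

/-- A Lie algebra `g`, a `g`-module `V` and an alternating `3`-cocycle of `g` with values in `V`,
in terms of linear maps. -/
structure CocycleData (K : Type*) [Field K] (g V : Type*) [AddCommGroup g] [Module K g]
    [AddCommGroup V] [Module K V] where
  br : g →ₗ[K] g →ₗ[K] g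
  act : g →ₗ[K] V →ₗ[K] V
  om : g →ₗ[K] g →ₗ[K] g →ₗ[K] V
  br_skew : ∀ x y, br x y = -br y x
  jacobi : ∀ x y z, br (br x y) z = br x (br y z) + br (br x z) y
  act_br : ∀ x y v, act (br x y) v = act x (act y v) - act y (act x v)
  om_swap_left : ∀ x y z, om y x z = -om x y z
  om_swap_right : ∀ x y z, om x z y = -om x y z
  cocycle : ∀ w x y z,
    om (br w x) y z - act y (om w x z) + om w (br x z) y + om (br w z) x y + om w x (br y z) =
      -act z (om w x y) + om (br w y) x z + om w (br x y) z - act x (om w y z) + act w (om x y z)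

namespace CocycleData

open FormalFun

variable {K : Type*} [Field K] {g V : Type*} [AddCommGroup g] [Module K g]
    [AddCommGroup V] [Module K V] (A : CocycleData K g V)

/-! ### The structure maps on formal functions -/

/-- The bracket of formal functions. -/
abbrev fbr (φ ψ : FormalFun K g g) : FormalFun K g g := conv A.br φ ψ

/-- The action of `g`-valued formal functions on `V`-valued formal functions. -/
abbrev fact (φ : FormalFun K g g) (ψ : FormalFun K g V) : FormalFun K g V := conv A.act φ ψ

/-- The cocycle, evaluated at formal functions. -/
abbrev fom (φ ψ χ : FormalFun K g g) : FormalFun K g V := conv LinearMap.id (conv A.om φ ψ) χ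

theorem fbr_skew (φ ψ : FormalFun K g g) : A.fbr φ ψ = -A.fbr ψ φ := conv_skew A.br_skew φ ψ

theorem fbr_jacobi (φ ψ χ : FormalFun K g g) :
    A.fbr (A.fbr φ ψ) χ = A.fbr φ (A.fbr ψ χ) + A.fbr (A.fbr φ χ) ψ := by
  ext m
  induction m using Multiset.induction generalizing φ ψ χ with
  | empty => simpa using A.jacobi (φ 0) (ψ 0) (χ 0)
  | cons z m ih =>
    simp only [add_at] at ih
    have h₁ := ih (D z φ) ψ χ
    have h₂ := ih φ (D z ψ) χ
    have h₃ := ih φ ψ (D z χ)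
    simp only [apply_cons, D_conv, map_add, LinearMap.add_apply, add_at]
    grind

theorem fact_fbr (φ ψ : FormalFun K g g) (η : FormalFun K g V) :
    A.fact (A.fbr φ ψ) η = A.fact φ (A.fact ψ η) - A.fact ψ (A.fact φ η) := by
  ext m
  induction m using Multiset.induction generalizing φ ψ η with
  | empty => simp [A.act_br]
  | cons z m ih =>
    simp only [sub_at] at ih
    simp only [apply_cons, D_conv, map_add, LinearMap.add_apply, add_at, sub_at, ih]
    abel

theorem fom_swap_left (φ ψ χ : FormalFun K g g) : A.fom ψ φ χ = -A.fom φ ψ χ := by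
  have h : conv A.om ψ φ = -conv A.om φ ψ :=
    conv_skew (fun x y => LinearMap.ext fun z => A.om_swap_left y x z) _ _
  rw [fom, h, map_neg, LinearMap.neg_apply]

theorem fom_swap_right (φ ψ χ : FormalFun K g g) : A.fom φ χ ψ = -A.fom φ ψ χ := by
  ext m
  induction m using Multiset.induction generalizing φ ψ χ with
  | empty => simpa using A.om_swap_right (φ 0) (ψ 0) (χ 0)
  | cons z m ih =>
    simp only [neg_at] at ih
    have h₁ := ih (D z φ) ψ χ
    have h₂ := ih φ (D z ψ) χ
    have h₃ := ih φ ψ (D z χ)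
    simp only [apply_cons, D_conv, map_add, LinearMap.add_apply, add_at, neg_at]
    grind

theorem fom_cocycle (φ ψ χ η : FormalFun K g g) :
    A.fom (A.fbr φ ψ) χ η - A.fact χ (A.fom φ ψ η) + A.fom φ (A.fbr ψ η) χ +
        A.fom (A.fbr φ η) ψ χ + A.fom φ ψ (A.fbr χ η) =
      -A.fact η (A.fom φ ψ χ) + A.fom (A.fbr φ χ) ψ η + A.fom φ (A.fbr ψ χ) η -
        A.fact ψ (A.fom φ χ η) + A.fact φ (A.fom ψ χ η) := by
  ext m
  induction m using Multiset.induction generalizing φ ψ χ η with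
  | empty => simpa using A.cocycle (φ 0) (ψ 0) (χ 0) (η 0)
  | cons z m ih =>
    simp only [add_at, sub_at, neg_at] at ih
    have h₁ := ih (D z φ) ψ χ η
    have h₂ := ih φ (D z ψ) χ η
    have h₃ := ih φ ψ (D z χ) η
    have h₄ := ih φ ψ χ (D z η)
    simp only [apply_cons, D_conv, map_add, LinearMap.add_apply, add_at,
      sub_at, neg_at]
    grind

/-! ### The Maurer–Cartan form -/

/-- The left invariant Maurer–Cartan form of the formal group of `g`, in exponential coordinates,
evaluated at a constant vector field. -/
noncomputable def mc : g →ₗ[K] FormalFun K g g := radialSolution A.br 1 ∘ₗ const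

/-- The form with given values at constant vector fields. -/
def ofConst {W₁ W₂ : Type*} [AddCommGroup W₁] [Module K W₁] [AddCommGroup W₂] [Module K W₂] :
    (W₁ →ₗ[K] FormalFun K g W₂) →ₗ[K] FormalFun K g (W₁ →ₗ[K] W₂) where
  toFun T := ⟨fun m => LinearMap.proj m ∘ₗ (FormalFun K g W₂).subtype ∘ₗ T, fun m =>
    ⟨fun x y => LinearMap.ext fun w => ((T w).2 m).map_add x y,
      fun c x => LinearMap.ext fun w => ((T w).2 m).map_smul c x⟩⟩
  map_add' _ _ := rfl
  map_smul' _ _ := rfl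

theorem eval_ofConst {W₁ W₂ : Type*} [AddCommGroup W₁] [Module K W₁] [AddCommGroup W₂] [Module K W₂]
    (T : W₁ →ₗ[K] FormalFun K g W₂) (w : W₁) : eval (ofConst T) (const w) = T w :=
  ext fun m => eval_const_form _ w m

/-- The Maurer–Cartan form. -/
noncomputable def mcForm : FormalFun K g (g →ₗ[K] g) := ofConst A.mc

theorem eval_mcForm_const (y : g) : eval A.mcForm (const y) = A.mc y := eval_ofConst A.mc y

variable [CharZero K]

theorem euler_mc (y : g) : euler (A.mc y) = const y - A.fbr coord (A.mc y) - A.mc y := by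
  have h := radialSolution_spec A.br one_ne_zero (const y)
  rw [Nat.cast_one, one_smul] at h
  exact eq_sub_of_add_eq h

theorem mc_apply_zero (y : g) : A.mc y 0 = y := by
  have h := congrArg (fun φ : FormalFun K g g => φ 0) (A.euler_mc y)
  simp only [euler_apply_zero, sub_at, const_apply_zero, conv_apply_zero, coord_apply_zero,
    map_zero, LinearMap.zero_apply, sub_zero] at h
  exact (sub_eq_zero.1 h.symm).symm

/-- The Maurer–Cartan equation, for constant vector fields. -/
theorem mc_equation (y z : g) :
    D y (A.mc z) - D z (A.mc y) + A.fbr (A.mc y) (A.mc z) = 0 := by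
  -- By the radial equation of `mc` and the Jacobi identity, the left side `R` satisfies `(N + 2) R
  -- = -[coord, R]`.
  refine radialSolution_unique A.br two_ne_zero ?_
  have j := A.fbr_jacobi coord (A.mc y) (A.mc z)
  have s₁ := A.fbr_skew (A.fbr coord (A.mc z)) (A.mc y)
  have s₂ := A.fbr_skew (const z) (A.mc y)
  simp only [Nat.cast_ofNat, two_smul, map_add, map_sub, euler_D, euler_conv, euler_mc, D_const,
    D_conv, D_coord, LinearMap.sub_apply]
  grind

/-- The Maurer–Cartan equation. -/
theorem mcForm_equation (ψ χ : FormalFun K g g) :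
    eval (deriv ψ A.mcForm) χ - eval (deriv χ A.mcForm) ψ +
      A.fbr (eval A.mcForm ψ) (eval A.mcForm χ) = 0 := by
  -- Only the form is differentiated, never the fields, so the expression is tensorial in each field
  -- and constant fields suffice.
  have h₁ : ∀ χ, Tensorial fun ψ => eval (deriv ψ A.mcForm) χ - eval (deriv χ A.mcForm) ψ +
      A.fbr (eval A.mcForm ψ) (eval A.mcForm χ) := fun χ =>
    (((Tensorial.eval_right _).conv_left _ χ).sub (.eval_right _)).add
      ((Tensorial.eval_right _).conv_left _ _)
  have h₂ : ∀ ψ, Tensorial fun χ => eval (deriv ψ A.mcForm) χ - eval (deriv χ A.mcForm) ψ +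
      A.fbr (eval A.mcForm ψ) (eval A.mcForm χ) := fun ψ =>
    ((Tensorial.eval_right _).sub ((Tensorial.eval_right _).conv_left _ ψ)).add
      ((Tensorial.eval_right _).conv_right _ _)
  have h₃ : ∀ y z : g, eval (D y A.mcForm) (const z) = D y (A.mc z) := fun y z => by
    rw [← eval_mcForm_const, D_conv, D_const, map_zero, add_zero]
  refine (h₁ χ).eq_zero (fun y => (h₂ (const y)).eq_zero (fun z => ?_) χ) ψ
  simp only [deriv_const_left, h₃, eval_mcForm_const, mc_equation]

/-! ### Left invariant vector fields -/

/-- The left invariant vector fields of the formal group of `g`. -/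
noncomputable def inv : g →ₗ[K] FormalFun K g g :=
  neumann (LinearMap.id - conv LinearMap.id A.mcForm) ∘ₗ const

omit [CharZero K] in
theorem eval_sub_left {W₁ W₂ : Type*} [AddCommGroup W₁] [Module K W₁] [AddCommGroup W₂]
    [Module K W₂] (F G : FormalFun K g (W₁ →ₗ[K] W₂)) (ψ : FormalFun K g W₁) :
    eval (F - G) ψ = eval F ψ - eval G ψ := by
  simp only [eval, map_sub, LinearMap.sub_apply]

/-- At the origin the Maurer–Cartan form is the identity. Hence it is invertible by a Neumann
series, which is how `inv` is defined. -/
theorem raises_id_sub_mcForm : Raises (LinearMap.id - conv LinearMap.id A.mcForm) := by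
  have h : LinearMap.id - conv LinearMap.id A.mcForm =
      conv LinearMap.id (const LinearMap.id - A.mcForm) := by
    refine LinearMap.ext fun ψ => ?_
    have := eval_sub_left (const LinearMap.id) A.mcForm ψ
    rw [eval_const_id] at this
    exact this.symm
  rw [h]
  refine raises_conv _ (LinearMap.ext fun y => ?_)
  rw [sub_at, const_apply_zero, LinearMap.sub_apply]
  exact sub_eq_zero.2 (A.mc_apply_zero y).symm

theorem eval_mcForm_inv (a : g) : eval A.mcForm (A.inv a) = const a := by
  have h := neumann_eq A.raises_id_sub_mcForm (const a : FormalFun K g g)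
  change A.inv a = const a + (A.inv a - eval A.mcForm (A.inv a)) at h
  have h' := congrArg (· + eval A.mcForm (A.inv a) - A.inv a) h
  simp only [add_sub_cancel_left] at h'
  rw [h']; abel

theorem eq_zero_of_eval_mcForm {ψ : FormalFun K g g} (h : eval A.mcForm ψ = 0) : ψ = 0 :=
  eq_zero_of_raises A.raises_id_sub_mcForm fun m hm => by
    change ψ m - (eval A.mcForm ψ) m = 0 at hm
    simpa [h] using hm

/-- The Maurer–Cartan form is injective on fields, so it suffices to compare its values.
Differentiating the constants `eval A.mcForm (A.inv b)` along `A.inv a`, and vice versa, turns the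
Maurer–Cartan equation into this comparison. -/
theorem inv_br (a b : g) :
    A.inv (A.br a b) = deriv (A.inv a) (A.inv b) - deriv (A.inv b) (A.inv a) := by
  refine (sub_eq_zero.1 (A.eq_zero_of_eval_mcForm ?_)).symm
  have h := A.mcForm_equation (A.inv a) (A.inv b)
  have h₁ : deriv (A.inv a) (const b : FormalFun K g g) = 0 := deriv_const_right _ _
  have h₂ : deriv (A.inv b) (const a : FormalFun K g g) = 0 := deriv_const_right _ _
  rw [← A.eval_mcForm_inv, eval, deriv_conv] at h₁ h₂
  simp only [eval_mcForm_inv, fbr, conv_const_const] at h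
  simp only [eval, map_sub, eval_mcForm_inv]
  grind

end CocycleData
end LieTwo

namespace LieTwo
namespace CocycleData

open FormalFun

variable {K : Type*} [Field K] {g V : Type*} [AddCommGroup g] [Module K g]
    [AddCommGroup V] [Module K V] (A : CocycleData K g V)

/-! ### A potential of the cocycle on the formal group -/

/-- The radial potential of the left invariant `3`-form defined by the cocycle, evaluated at two
constant vector fields. -/
noncomputable def pot : g →ₗ[K] g →ₗ[K] FormalFun K g V :=
  LinearMap.mk₂ K (fun y z => radialSolution A.act 2 (A.fom coord (A.mc y) (A.mc z)))
    (fun _ _ _ => by simp only [fom, map_add, LinearMap.add_apply])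
    (fun _ _ _ => by simp only [fom, map_smul, LinearMap.smul_apply])
    (fun _ _ _ => by simp only [map_add])
    (fun _ _ _ => by simp only [map_smul])

/-- The radial potential, as a form. -/
noncomputable def potForm : FormalFun K g (g →ₗ[K] g →ₗ[K] V) := ofConst (ofConst ∘ₗ A.pot)

/-- The radial potential, evaluated at two vector fields. -/
noncomputable abbrev fpot (ψ χ : FormalFun K g g) : FormalFun K g V := eval (eval A.potForm ψ) χ

theorem fpot_const (y z : g) : A.fpot (const y) (const z) = A.pot y z := by
  rw [fpot, potForm, eval_ofConst, LinearMap.comp_apply, eval_ofConst]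

theorem pot_skew (y z : g) : A.pot y z = -A.pot z y := by
  simp only [pot, LinearMap.mk₂_apply]
  rw [← map_neg, A.fom_swap_right]

theorem fpot_skew (ψ χ : FormalFun K g g) : A.fpot ψ χ = -A.fpot χ ψ := by
  have h₁ : ∀ χ, Tensorial fun ψ => A.fpot ψ χ + A.fpot χ ψ := fun χ =>
    ((Tensorial.eval_right _).conv_left _ χ).add (.eval_right _)
  have h₂ : ∀ ψ, Tensorial fun χ => A.fpot ψ χ + A.fpot χ ψ := fun ψ =>
    (Tensorial.eval_right _).add ((Tensorial.eval_right _).conv_left _ ψ)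
  refine eq_neg_of_add_eq_zero_left
    ((h₁ χ).eq_zero (fun y => (h₂ (const y)).eq_zero (fun z => ?_) χ) ψ)
  simp only [fpot_const]
  rw [A.pot_skew y z, neg_add_cancel]

variable [CharZero K]

theorem euler_pot (y z : g) : euler (A.pot y z) =
    A.fom coord (A.mc y) (A.mc z) - A.fact coord (A.pot y z) - (A.pot y z + A.pot y z) := by
  have h := radialSolution_spec A.act two_ne_zero (A.fom coord (A.mc y) (A.mc z))
  rw [Nat.cast_ofNat, two_smul] at h
  exact eq_sub_of_add_eq h

/-- The covariant differential of the potential is the given `3`-form, for constant vector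
fields. -/
theorem pot_equation (x y z : g) :
    (D x (A.pot y z) + A.fact (A.mc x) (A.pot y z)) +
      (D y (A.pot z x) + A.fact (A.mc y) (A.pot z x)) +
      (D z (A.pot x y) + A.fact (A.mc z) (A.pot x y)) - A.fom (A.mc x) (A.mc y) (A.mc z) = 0 := by
  -- The covariant Lie derivative along the Euler field commutes with the covariant differential and
  -- equals `N + 3 + coord · _` on the coefficients of 3-forms. By the choice of `pot` and the
  -- closedness of the 3-form, it kills the difference.
  refine radialSolution_unique A.act three_ne_zero ?_
  -- Closedness of the 3-form, contracted with the Euler field, whose Maurer–Cartan value is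
  -- `coord`; `e` then replaces brackets of Maurer–Cartan values by derivatives.
  have c := A.fom_cocycle coord (A.mc x) (A.mc y) (A.mc z)
  have e (a b : g) : A.fbr (A.mc a) (A.mc b) = D b (A.mc a) - D a (A.mc b) := by
    have := A.mc_equation a b
    grind
  have f (a : g) (η : FormalFun K g V) : A.fact (A.fbr coord (A.mc a)) η =
      A.fact coord (A.fact (A.mc a) η) - A.fact (A.mc a) (A.fact coord η) :=
    A.fact_fbr _ _ _
  have s₁ := A.fom_swap_right coord (A.mc x) (A.mc z)
  have s₂ := A.fom_swap_right coord (D x (A.mc z)) (A.mc y)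
  have s₃ := A.fom_swap_right coord (D y (A.mc z)) (A.mc x)
  have s₄ := A.fom_swap_right coord (D y (A.mc x)) (A.mc z)
  have s₅ (φ : FormalFun K g g) : A.fom (A.mc x) (A.mc y) φ = A.fom φ (A.mc x) (A.mc y) := by
    rw [A.fom_swap_right, A.fom_swap_left, neg_neg]
  have s₆ (φ : FormalFun K g g) : A.fom (A.mc x) φ (A.mc z) = -A.fom φ (A.mc x) (A.mc z) :=
    A.fom_swap_left _ _ _
  have s₇ := A.fom_swap_right (const y) (A.mc x) (A.mc z)
  have s₈ := congrArg (A.fact (A.mc y)) s₁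
  have hthree : ((3 : ℕ) : K) = 1 + 1 + 1 := by norm_num
  simp only [e, map_sub, map_neg, LinearMap.sub_apply, fom, fact, fbr] at c f s₁ s₂ s₃ s₄ s₅ s₆ s₇ s₈
  simp only [fom, fact, fbr, hthree, add_smul, one_smul, map_add, map_sub, euler_D, euler_conv,
    euler_mc, D_conv, D_coord, LinearMap.sub_apply, LinearMap.add_apply, euler_pot, f]
  linear_combination (norm := abel) c + s₂ + s₃ + s₄ + s₈ + s₇ - s₆ (const y) + s₆ (conv A.br coord (A.mc y))
    - s₅ (const z) + s₅ (conv A.br coord (A.mc z))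

/-- The covariant differential of the potential is the given `3`-form. -/
theorem fpot_equation (φ ψ χ : FormalFun K g g) :
    (eval (eval (deriv φ A.potForm) ψ) χ + A.fact (eval A.mcForm φ) (A.fpot ψ χ)) +
      (eval (eval (deriv ψ A.potForm) χ) φ + A.fact (eval A.mcForm ψ) (A.fpot χ φ)) +
      (eval (eval (deriv χ A.potForm) φ) ψ + A.fact (eval A.mcForm χ) (A.fpot φ ψ)) -
      A.fom (eval A.mcForm φ) (eval A.mcForm ψ) (eval A.mcForm χ) = 0 := by
  set T : FormalFun K g g → FormalFun K g g → FormalFun K g g → FormalFun K g V := fun φ ψ χ =>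
    (eval (eval (deriv φ A.potForm) ψ) χ + A.fact (eval A.mcForm φ) (A.fpot ψ χ)) +
      (eval (eval (deriv ψ A.potForm) χ) φ + A.fact (eval A.mcForm ψ) (A.fpot χ φ)) +
      (eval (eval (deriv χ A.potForm) φ) ψ + A.fact (eval A.mcForm χ) (A.fpot φ ψ)) -
      A.fom (eval A.mcForm φ) (eval A.mcForm ψ) (eval A.mcForm χ) with hT
  -- Cyclic invariance reduces tensoriality in three arguments to tensoriality in the first.
  have hcycle (φ ψ χ) : T φ ψ χ = T ψ χ φ := by
    have h : A.fom (eval A.mcForm φ) (eval A.mcForm ψ) (eval A.mcForm χ) =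
        A.fom (eval A.mcForm ψ) (eval A.mcForm χ) (eval A.mcForm φ) := by
      rw [A.fom_swap_right (eval A.mcForm ψ), A.fom_swap_left (eval A.mcForm φ), neg_neg]
    simp only [hT, h]
    abel
  have htens (ψ χ) : Tensorial fun φ => T φ ψ χ := by
    refine .sub (.add (.add (.add ?_ ?_) (.add ?_ ?_)) (.add ?_ ?_)) ?_
    · exact ((Tensorial.eval_right (grad A.potForm)).conv_left _ ψ).conv_left _ χ
    · exact (Tensorial.eval_right _).conv_left _ _
    · exact .eval_right _
    · exact (Tensorial.eval_right _).conv_right _ _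
    · exact (Tensorial.eval_right _).conv_left _ _
    · exact ((Tensorial.eval_right _).conv_left _ _).conv_right _ _
    · exact ((Tensorial.eval_right _).conv_left _ _).conv_left _ _
  have hD (x y z : g) : eval (eval (D x A.potForm) (const y)) (const z) = D x (A.pot y z) := by
    rw [← fpot_const, D_conv, D_conv, D_const, D_const, map_zero, map_zero, add_zero, add_zero]
  have hconst (x y z : g) : T (const x) (const y) (const z) = 0 := by
    simp only [hT, deriv_const_left, hD, fpot_const, eval_mcForm_const]
    exact A.pot_equation x y z
  refine (htens ψ χ).eq_zero (fun x => ?_) φ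
  rw [hcycle]
  refine (htens χ (const x)).eq_zero (fun y => ?_) ψ
  rw [hcycle]
  refine (htens (const x) (const y)).eq_zero (fun z => ?_) χ
  rw [hcycle, hconst]

/-! ### The module of formal functions -/

/-- The action of `g` on the formal functions with values in `V`, by left invariant vector fields
and the action on the values. -/
noncomputable def iact : g →ₗ[K] FormalFun K g V →ₗ[K] FormalFun K g V :=
  LinearMap.mk₂ K (fun a φ => deriv (A.inv a) φ + A.fact (const a) φ)
    (fun _ _ _ => by
      simp only [fact, map_add, LinearMap.add_apply, deriv_add_left]; abel)
    (fun _ _ _ => by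
      simp only [fact, map_smul, LinearMap.smul_apply, deriv_smul_left, smul_add])
    (fun _ _ _ => by simp only [fact, map_add]; abel)
    (fun _ _ _ => by simp only [fact, map_smul, smul_add])

omit [CharZero K] in
theorem iact_apply (a : g) (φ : FormalFun K g V) :
    A.iact a φ = deriv (A.inv a) φ + A.fact (const a) φ := rfl

-- Derivatives kill constants, so `V` sits in the formal functions as a `g`-submodule, and the
-- action descends to the quotient.
omit [CharZero K] in
theorem iact_const (a : g) (v : V) : A.iact a (const v) = const (A.act a v) := by
  rw [iact_apply, deriv_const_right, zero_add, fact, conv_const_const]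

/-- Left invariant fields represent `g` by `inv_br`, the values by `fact_fbr`, and the mixed terms
cancel because the coefficients `const a` have zero derivative. -/
theorem iact_br (a b : g) (φ : FormalFun K g V) :
    A.iact (A.br a b) φ = A.iact a (A.iact b φ) - A.iact b (A.iact a φ) := by
  have h₁ := deriv_deriv_sub (A.inv a) (A.inv b) φ
  have h₂ := A.fact_fbr (const a) (const b) φ
  rw [fbr, conv_const_const] at h₂
  simp only [iact_apply, inv_br, fact, map_add, deriv_conv, deriv_const_right, map_zero,
    LinearMap.zero_apply] at h₁ h₂ ⊢
  linear_combination (norm := abel) h₂ - h₁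

/-- The potential of the cocycle, as a cochain of `g` with values in the module of formal
functions. -/
noncomputable def primitive : g →ₗ[K] g →ₗ[K] FormalFun K g V :=
  LinearMap.mk₂ K (fun a b => A.fpot (A.inv a) (A.inv b))
    (fun _ _ _ => by simp only [fpot, eval, map_add, LinearMap.add_apply])
    (fun _ _ _ => by simp only [fpot, eval, map_smul, LinearMap.smul_apply])
    (fun _ _ _ => by simp only [fpot, eval, map_add])
    (fun _ _ _ => by simp only [fpot, eval, map_smul])

omit [CharZero K] in
theorem primitive_apply (a b : g) : A.primitive a b = A.fpot (A.inv a) (A.inv b) := rfl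

omit [CharZero K] in
theorem primitive_skew (a b : g) : A.primitive a b = -A.primitive b a := A.fpot_skew _ _

/-- In the module of formal functions, the cocycle is a coboundary. -/
theorem primitive_equation (a b c : g) :
    A.iact a (A.primitive b c) + A.iact b (A.primitive c a) + A.iact c (A.primitive a b) -
      (A.primitive (A.br a b) c + A.primitive (A.br b c) a + A.primitive (A.br c a) b) =
      const (A.om a b c) := by
  -- On left invariant fields the Maurer–Cartan form is constant, so the covariant differential
  -- becomes the Lie algebra coboundary with coefficients in formal functions.
  have h := A.fpot_equation (A.inv a) (A.inv b) (A.inv c)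
  have hs (ψ χ : FormalFun K g g) : A.fpot ψ χ = -A.fpot χ ψ := A.fpot_skew _ _
  have s₁ := hs (deriv (A.inv a) (A.inv c)) (A.inv b)
  have s₂ := hs (deriv (A.inv b) (A.inv a)) (A.inv c)
  have s₃ := hs (deriv (A.inv c) (A.inv b)) (A.inv a)
  simp only [iact_apply, primitive_apply, inv_br, eval_mcForm_inv, fpot, fom, eval, conv_const_const,
    deriv_conv, map_sub, LinearMap.sub_apply, LinearMap.id_apply, map_add, LinearMap.add_apply]
    at h s₁ s₂ s₃ ⊢
  linear_combination (norm := abel) h + s₁ + s₂ + s₃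

end CocycleData
end LieTwo

namespace LieTwo

/-! ## Abelian extensions of Lie algebras -/

/-- A Lie algebra `g`, a `g`-module `M` and a `2`-cocycle of `g` with values in `M`, in terms of
linear maps. -/
structure ExtensionData (K : Type*) [Field K] (g M : Type*) [AddCommGroup g] [Module K g]
    [AddCommGroup M] [Module K M] where
  br : g →ₗ[K] g →ₗ[K] g
  act : g →ₗ[K] M →ₗ[K] M
  al : g →ₗ[K] g →ₗ[K] M
  br_self : ∀ x, br x x = 0
  jacobi : ∀ x y z, br x (br y z) = br (br x y) z + br y (br x z)
  act_br : ∀ x y v, act (br x y) v = act x (act y v) - act y (act x v)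
  al_self : ∀ x, al x x = 0
  cocycle : ∀ x y z, act x (al y z) + al x (br y z) =
    -act z (al x y) + al (br x y) z + act y (al x z) + al y (br x z)

namespace ExtensionData

variable {K : Type*} [Field K] {g M : Type*} [AddCommGroup g] [Module K g]
    [AddCommGroup M] [Module K M]

/-- The vector space underlying the extension. -/
def Carrier (_ : ExtensionData K g M) : Type _ := g × M

variable (E : ExtensionData K g M)

instance : AddCommGroup E.Carrier := inferInstanceAs (AddCommGroup (g × M))

instance : Module K E.Carrier := inferInstanceAs (Module K (g × M))

instance : Bracket E.Carrier E.Carrier where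
  bracket x y := (E.br x.1 y.1, E.act x.1 y.2 - E.act y.1 x.2 + E.al x.1 y.1)

@[simp] theorem fst_add (x y : E.Carrier) : (x + y).1 = x.1 + y.1 := rfl
@[simp] theorem snd_add (x y : E.Carrier) : (x + y).2 = x.2 + y.2 := rfl
@[simp] theorem fst_smul (c : K) (x : E.Carrier) : (c • x).1 = c • x.1 := rfl
@[simp] theorem snd_smul (c : K) (x : E.Carrier) : (c • x).2 = c • x.2 := rfl
@[simp] theorem fst_lie (x y : E.Carrier) : ⁅x, y⁆.1 = E.br x.1 y.1 := rfl
@[simp] theorem snd_lie (x y : E.Carrier) :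
    ⁅x, y⁆.2 = E.act x.1 y.2 - E.act y.1 x.2 + E.al x.1 y.1 := rfl

theorem carrier_ext {x y : E.Carrier} (h₁ : x.1 = y.1) (h₂ : x.2 = y.2) : x = y := Prod.ext h₁ h₂

instance : LieRing E.Carrier where
  add_lie x y z := E.carrier_ext (by simp) (by simp; abel)
  lie_add x y z := E.carrier_ext (by simp) (by simp; abel)
  lie_self x := E.carrier_ext (E.br_self x.1) (by
    change E.act x.1 x.2 - E.act x.1 x.2 + E.al x.1 x.1 = 0
    rw [E.al_self, sub_self, add_zero])
  leibniz_lie x y z := E.carrier_ext (E.jacobi x.1 y.1 z.1) (by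
    simp only [snd_lie, fst_lie, snd_add, map_add, map_sub, E.act_br]
    linear_combination (norm := abel) E.cocycle x.1 y.1 z.1)

instance : LieAlgebra K E.Carrier where
  lie_smul c x y := E.carrier_ext (by simp) (by simp [smul_sub, smul_add])

end ExtensionData

/-! ## Crossed modules with abelian source -/

namespace CrossedModule

variable {K : Type v} [Field K] (X : CrossedModule.{v, u} K)

/-- If `h` is abelian, then the action of `g` on `h` descends to `g / μ(h)`. -/
def cokerAct [IsLieAbelian X.h] : X.Coker →ₗ⁅K⁆ LieDerivation K X.h X.h where
  toLinearMap := Submodule.liftQ X.imageIdeal.toSubmodule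
    (X.act : X.g →ₗ[K] LieDerivation K X.h X.h) (by
      rintro _ ⟨a, rfl⟩
      refine LinearMap.mem_ker.2 (LieDerivation.ext fun b => ?_)
      -- By the Peiffer identity `μ a` acts as `ad a`, which is zero on an abelian `h`.
      exact (X.act_μ a b).trans (trivial_lie_zero _ _ _ _))
  map_lie' := by
    intro x y
    induction x using Submodule.Quotient.induction_on with | _ x
    induction y using Submodule.Quotient.induction_on with | _ y
    exact X.act.map_lie x y

theorem cokerAct_toCoker [IsLieAbelian X.h] (x : X.g) : X.cokerAct (X.toCoker x) = X.act x := rfl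

theorem isCokerModule_of_isLieAbelian [IsLieAbelian X.h] : X.IsCokerModule := by
  refine ⟨{ bracket := fun x a => X.cokerAct x a, add_lie := ?_, lie_add := ?_, leibniz_lie := ?_ },
    @LieModule.mk _ _ _ _ _ _ _ _ (_) ?_ ?_, fun _ _ => rfl⟩
  · intro x y a; change X.cokerAct (x + y) a = X.cokerAct x a + X.cokerAct y a; simp
  · intro x a b; simp
  · intro x y a
    change X.cokerAct x (X.cokerAct y a) = X.cokerAct ⁅x, y⁆ a + X.cokerAct y (X.cokerAct x a)
    rw [LieHom.map_lie, LieDerivation.commutator_apply]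
    abel
  · intro c x a; change X.cokerAct (c • x) a = c • X.cokerAct x a; simp
  · intro c x a; change X.cokerAct x (c • a) = c • X.cokerAct x a; simp

theorem outerActionIsGenuine_of_isLieAbelian [IsLieAbelian X.h] : X.OuterActionIsGenuine := by
  refine ⟨X.cokerAct, fun x => ?_, X.cokerAct_toCoker⟩
  induction x using Submodule.Quotient.induction_on with | _ x
  rfl

end CrossedModule
end LieTwo

namespace LieTwo
namespace CocycleData

open FormalFun

variable {K : Type v} [Field K] {g V : Type u} [AddCommGroup g] [Module K g]
    [AddCommGroup V] [Module K V] (A : CocycleData K g V)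

/-! ## The skeletal Lie 2-algebra of a 3-cocycle -/

/-- The skeletal `2`-vector space with objects `g` and with `V` as automorphisms of each object. -/
def skeletalSpace (K : Type v) [Field K] (g V : Type u) [AddCommGroup g] [Module K g]
    [AddCommGroup V] [Module K V] : TwoVectorSpace.{v, u} K where
  Obj := g
  Arr := g × V
  s := LinearMap.fst K g V
  t := LinearMap.fst K g V
  i := LinearMap.inl K g V
  m :=
    { toFun := fun p => (p.1.1.1, p.1.1.2 + p.1.2.2)
      map_add' := fun _ _ => Prod.ext rfl (add_add_add_comm _ _ _ _)
      map_smul' := fun _ _ => Prod.ext rfl (smul_add _ _ _).symm }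
  s_i _ := rfl
  t_i _ := rfl
  s_m _ := rfl
  t_m p := p.2
  i_m _ := Prod.ext rfl (zero_add _)
  m_i _ := Prod.ext rfl (add_zero _)
  m_assoc _ _ _ _ _ := Prod.ext rfl (add_assoc _ _ _)

/-- The bracket on arrows of the skeletal Lie `2`-algebra. -/
def skeletalBr : g × V →ₗ[K] g × V →ₗ[K] g × V :=
  LinearMap.mk₂ K (fun p q => (A.br p.1 q.1, A.act p.1 q.2 - A.act q.1 p.2))
    (fun p p' q => Prod.ext (by simp) (by simp; abel))
    (fun c p q => Prod.ext (by simp) (by simp [smul_sub]))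
    (fun p q q' => Prod.ext (by simp) (by simp; abel))
    (fun c p q => Prod.ext (by simp) (by simp [smul_sub]))

/-- The Jacobiator of the skeletal Lie `2`-algebra. -/
def skeletalJ : g →ₗ[K] g →ₗ[K] g →ₗ[K] g × V :=
  LinearMap.mk₂ K (fun x y => (A.br (A.br x y)).prod (A.om x y))
    (fun x x' y => by ext z <;> simp)
    (fun c x y => by ext z <;> simp)
    (fun x y y' => by ext z <;> simp)
    (fun c x y => by ext z <;> simp)

/-- The skeletal bracket and Jacobiator. -/
def skeletalBracket : BracketTwoVectorSpace.{v, u} K where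
  V := skeletalSpace K g V
  br₀ := A.br
  br₁ := A.skeletalBr
  br₀_skew := A.br_skew
  br₁_skew p q := Prod.ext (A.br_skew _ _) (neg_sub _ _).symm
  s_br _ _ := rfl
  t_br _ _ := rfl
  br_i x y := Prod.ext rfl (by
    change A.act x 0 - A.act y 0 = 0
    rw [map_zero, map_zero, sub_zero])
  br_comp f f' g g' hf hg := by
    have hf : f.1 = f'.1 := hf
    have hg : g.1 = g'.1 := hg
    refine Prod.ext rfl ?_
    change A.act f.1 (g.2 + g'.2) - A.act g.1 (f.2 + f'.2) =
      A.act f.1 g.2 - A.act g.1 f.2 + (A.act f'.1 g'.2 - A.act g'.1 f'.2)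
    rw [map_add, map_add, hf, hg]
    abel
  J := A.skeletalJ
  s_J _ _ _ := rfl
  t_J x y z := A.jacobi x y z
  J_natural f g h := by
    refine Prod.ext rfl ?_
    change A.act (A.br f.1 g.1) h.2 - A.act h.1 (A.act f.1 g.2 - A.act g.1 f.2) + A.om f.1 g.1 h.1 =
      A.om f.1 g.1 h.1 + (A.act f.1 (A.act g.1 h.2 - A.act h.1 g.2) - A.act (A.br g.1 h.1) f.2 +
        (A.act (A.br f.1 h.1) g.2 - A.act g.1 (A.act f.1 h.2 - A.act h.1 f.2)))
    simp only [A.act_br, map_sub]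
    abel
  J_antisymm_left (x y z : g) := by
    refine Prod.ext ?_ ?_
    · change A.br (A.br y x) z - A.br (A.br y x) z = -(A.br (A.br x y) z - A.br (A.br x y) z)
      abel
    · change A.om y x z - 0 = -(A.om x y z - 0)
      rw [A.om_swap_left, sub_zero, sub_zero]
  J_antisymm_right (x y z : g) := by
    refine Prod.ext ?_ ?_
    · change A.br (A.br x z) y - A.br (A.br x z) y = -(A.br (A.br x y) z - A.br (A.br x y) z)
      abel
    · change A.om x z y - 0 = -(A.om x y z - 0)
      rw [A.om_swap_right, sub_zero, sub_zero]

/-- The skeletal Lie `2`-algebra of a `3`-cocycle. -/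
def skeletal : SemistrictLieTwoAlgebra.{v, u} K where
  toBracketTwoVectorSpace := A.skeletalBracket
  jacobiator_identity (w x y z : g) := by
    refine Prod.ext rfl ?_
    change A.om (A.br w x) y z +
        ((A.act (A.br (A.br w x) z) 0 - A.act y (A.om w x z)) + 0) +
        (A.om w (A.br x z) y + A.om (A.br w z) x y + A.om w x (A.br y z)) =
      (A.act (A.br (A.br w x) y) 0 - A.act z (A.om w x y)) +
        (A.om (A.br w y) x z + A.om w (A.br x y) z) +
        ((A.act (A.br (A.br w y) z) 0 - A.act x (A.om w y z)) + 0) +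
        ((A.act w (A.om x y z) - A.act (A.br (A.br x y) z) 0) + 0)
    simp only [map_zero]
    linear_combination (norm := abel) A.cocycle w x y z

/-! ## The strict Lie 2-algebra of a 3-cocycle -/

/-- Formal functions modulo constants. -/
abbrev FunQuot (K : Type v) [Field K] (g V : Type u) [AddCommGroup g] [Module K g]
    [AddCommGroup V] [Module K V] : Type u :=
  FormalFun K g V ⧸ LinearMap.range (const : V →ₗ[K] FormalFun K g V)

/-- The projection to formal functions modulo constants. -/
noncomputable abbrev toQuot (_ : CocycleData K g V) : FormalFun K g V →ₗ[K] FunQuot K g V :=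
  (LinearMap.range (const : V →ₗ[K] FormalFun K g V)).mkQ

theorem toQuot_const (v : V) : A.toQuot (const v : FormalFun K g V) = 0 :=
  (Submodule.Quotient.mk_eq_zero _).2 ⟨v, rfl⟩

/-- The action of `g` on formal functions modulo constants. -/
noncomputable def qact : g →ₗ[K] FunQuot K g V →ₗ[K] FunQuot K g V :=
  (Submodule.liftQ _ (A.iact.flip.compr₂ A.toQuot) (by
    rintro _ ⟨v, rfl⟩
    refine LinearMap.mem_ker.2 (LinearMap.ext fun a => ?_)
    change A.toQuot (A.iact a (const v)) = 0
    rw [iact_const, toQuot_const])).flip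

theorem qact_toQuot (a : g) (φ : FormalFun K g V) : A.qact a (A.toQuot φ) = A.toQuot (A.iact a φ) := rfl

theorem eq_zero_of_eq_neg_self (K : Type*) {W : Type*} [Field K] [CharZero K] [AddCommGroup W]
    [Module K W] {w : W} (h : w = -w) : w = 0 := by
  rw [eq_neg_iff_add_eq_zero, ← two_smul K] at h
  exact (smul_eq_zero.1 h).resolve_left two_ne_zero

theorem br_self [CharZero K] (x : g) : A.br x x = 0 := eq_zero_of_eq_neg_self K (A.br_skew x x)

/-- The coboundary of the primitive is the constant `om x y z`, which dies in the quotient. The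
class of `om` is thus the image of this 2-cocycle under the connecting map of `V → F → F / V`, up to
sign conventions. -/
theorem toQuot_primitive_cocycle [CharZero K] (x y z : g) :
    A.qact x (A.toQuot (A.primitive y z)) + A.toQuot (A.primitive x (A.br y z)) =
      -A.qact z (A.toQuot (A.primitive x y)) + A.toQuot (A.primitive (A.br x y) z) +
        A.qact y (A.toQuot (A.primitive x z)) + A.toQuot (A.primitive y (A.br x z)) := by
  have h := congrArg A.toQuot (A.primitive_equation x y z)
  rw [toQuot_const, A.primitive_skew z x, A.br_skew z x, A.primitive_skew (A.br y z) x,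
    map_neg A.primitive, LinearMap.neg_apply, A.primitive_skew (A.br x z) y] at h
  simp only [map_add, map_sub, map_neg, ← qact_toQuot] at h ⊢
  linear_combination (norm := abel) h

variable [CharZero K]

/-- The Lie algebra of objects, an extension of `g` by the formal functions modulo constants. -/
noncomputable def objData : ExtensionData K g (FunQuot K g V) where
  br := A.br
  act := A.qact
  -- With this sign, `primitive x y` is the formal-function component of an arrow from the bracket
  -- of `(x, 0)` and `(y, 0)` to `(br x y, 0)`.
  al := -A.primitive.compr₂ A.toQuot
  br_self := A.br_self
  jacobi x y z := by
    rw [A.jacobi x y z, A.br_skew y (A.br x z), add_assoc, add_neg_cancel, add_zero]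
  act_br x y v := by
    induction v using Submodule.Quotient.induction_on with | _ φ
    change A.toQuot (A.iact (A.br x y) φ) =
      A.toQuot (A.iact x (A.iact y φ)) - A.toQuot (A.iact y (A.iact x φ))
    rw [A.iact_br, map_sub]
  al_self x := by
    change -A.toQuot (A.primitive x x) = 0
    rw [eq_zero_of_eq_neg_self K (A.primitive_skew x x), map_zero, neg_zero]
  cocycle x y z := by
    have h := A.toQuot_primitive_cocycle x y z
    change A.qact x (-A.toQuot (A.primitive y z)) + -A.toQuot (A.primitive x (A.br y z)) =
      -A.qact z (-A.toQuot (A.primitive x y)) + -A.toQuot (A.primitive (A.br x y) z) +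
        A.qact y (-A.toQuot (A.primitive x z)) + -A.toQuot (A.primitive y (A.br x z))
    simp only [map_neg]
    linear_combination (norm := abel) -h

/-- The Lie algebra of arrows, an extension of `g` by the formal functions modulo constants and
the formal functions. -/
noncomputable def arrData : ExtensionData K g (FunQuot K g V × FormalFun K g V) where
  br := A.br
  act := LinearMap.mk₂ K (fun a p => (A.qact a p.1, A.iact a p.2))
    (fun _ _ _ => Prod.ext (by simp) (by simp)) (fun _ _ _ => Prod.ext (by simp) (by simp))
    (fun _ _ _ => Prod.ext (by simp) (by simp)) (fun _ _ _ => Prod.ext (by simp) (by simp))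
  -- Only the component in the quotient is twisted; the formal functions form an untwisted
  -- `g`-module.
  al := (-A.primitive.compr₂ A.toQuot).compr₂ (LinearMap.inl K _ _)
  br_self := A.br_self
  jacobi := A.objData.jacobi
  act_br x y v := Prod.ext (A.objData.act_br x y v.1) (A.iact_br x y v.2)
  al_self x := Prod.ext (A.objData.al_self x) rfl
  cocycle x y z := Prod.ext (A.objData.cocycle x y z) (by
    change A.iact x 0 + 0 = -A.iact z 0 + 0 + A.iact y 0 + 0
    simp)

/-- The source map of the strict Lie `2`-algebra of a `3`-cocycle. -/
noncomputable def strictSource : A.arrData.Carrier →ₗ⁅K⁆ A.objData.Carrier where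
  toFun f := (f.1, f.2.1)
  map_add' _ _ := rfl
  map_smul' _ _ := rfl
  map_lie' := rfl

/-- The target map of the strict Lie `2`-algebra of a `3`-cocycle. -/
noncomputable def strictTarget : A.arrData.Carrier →ₗ⁅K⁆ A.objData.Carrier where
  toFun f := (f.1, f.2.1 + A.toQuot f.2.2)
  map_add' f f' := Prod.ext rfl (by
    change f.2.1 + f'.2.1 + A.toQuot (f.2.2 + f'.2.2) = _ + _
    rw [map_add, add_add_add_comm])
  map_smul' c f := Prod.ext rfl (by
    change c • f.2.1 + A.toQuot (c • f.2.2) = c • (_ + _)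
    rw [map_smul, smul_add])
  map_lie' {f f'} := Prod.ext rfl (by
    change A.qact f.1 f'.2.1 - A.qact f'.1 f.2.1 + -A.toQuot (A.primitive f.1 f'.1) +
        A.toQuot (A.iact f.1 f'.2.2 - A.iact f'.1 f.2.2 + 0) =
      A.qact f.1 (f'.2.1 + A.toQuot f'.2.2) - A.qact f'.1 (f.2.1 + A.toQuot f.2.2) +
        -A.toQuot (A.primitive f.1 f'.1)
    simp only [map_add, map_sub, qact_toQuot, map_zero]
    abel)

/-- The identity map of the strict Lie `2`-algebra of a `3`-cocycle. -/
noncomputable def strictIdentity : A.objData.Carrier →ₗ⁅K⁆ A.arrData.Carrier where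
  toFun x := (x.1, x.2, 0)
  map_add' _ _ := Prod.ext rfl (Prod.ext rfl (add_zero _).symm)
  map_smul' _ _ := Prod.ext rfl (Prod.ext rfl (smul_zero _).symm)
  map_lie' {x y} := Prod.ext rfl (Prod.ext rfl (by
    change 0 = A.iact x.1 0 - A.iact y.1 0 + 0
    simp))

theorem fst_lie_arrData (f f' : A.arrData.Carrier) : ⁅f, f'⁆.1 = A.br f.1 f'.1 := rfl

theorem fst_snd_lie_arrData (f f' : A.arrData.Carrier) : ⁅f, f'⁆.2.1 =
    A.qact f.1 f'.2.1 - A.qact f'.1 f.2.1 + -A.toQuot (A.primitive f.1 f'.1) := rfl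

theorem snd_snd_lie_arrData (f f' : A.arrData.Carrier) :
    ⁅f, f'⁆.2.2 = A.iact f.1 f'.2.2 - A.iact f'.1 f.2.2 + 0 := rfl

/-- The composite of two arrows of the strict Lie `2`-algebra of a `3`-cocycle. -/
def strictMul (f f' : A.arrData.Carrier) : A.arrData.Carrier := (f.1, f.2.1, f.2.2 + f'.2.2)

/-- Composable arrows share their `g`-component, and for fixed `g`-components the bracket is
additive in the formal functions. -/
theorem strictMul_lie {f f' h h' : A.arrData.Carrier} (hf : f.1 = f'.1) (hh : h.1 = h'.1) :
    A.strictMul ⁅f, h⁆ ⁅f', h'⁆ = ⁅A.strictMul f f', A.strictMul h h'⁆ := by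
  refine Prod.ext ?_ (Prod.ext ?_ ?_)
  · rw [fst_lie_arrData]; exact A.fst_lie_arrData f h
  · rw [fst_snd_lie_arrData]; exact A.fst_snd_lie_arrData f h
  · rw [snd_snd_lie_arrData]
    change ⁅f, h⁆.2.2 + ⁅f', h'⁆.2.2 = A.iact f.1 (h.2.2 + h'.2.2) - A.iact h.1 (f.2.2 + f'.2.2) + 0
    rw [snd_snd_lie_arrData, snd_snd_lie_arrData, hf, hh, map_add, map_add]
    abel

/-- Composition in the strict Lie `2`-algebra of a `3`-cocycle. -/
noncomputable def strictComp :
    ↥(composablePairs A.strictSource A.strictTarget) →ₗ⁅K⁆ A.arrData.Carrier where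
  toFun p := A.strictMul p.1.1 p.1.2
  map_add' _ _ := Prod.ext rfl (Prod.ext rfl (add_add_add_comm _ _ _ _))
  map_smul' _ _ := Prod.ext rfl (Prod.ext rfl (smul_add _ _ _).symm)
  map_lie' {p q} :=
    have hp : A.strictTarget p.1.1 = A.strictSource p.1.2 := p.2
    have hq : A.strictTarget q.1.1 = A.strictSource q.1.2 := q.2
    A.strictMul_lie (congrArg (fun e : A.objData.Carrier => e.1) hp)
      (congrArg (fun e : A.objData.Carrier => e.1) hq)

/-- The strict Lie `2`-algebra of a `3`-cocycle. -/
noncomputable def strict : StrictLieTwoAlgebra.{v, u} K where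
  Obj := A.objData.Carrier
  Arr := A.arrData.Carrier
  s := A.strictSource
  t := A.strictTarget
  i := A.strictIdentity
  m := A.strictComp
  s_i _ := rfl
  t_i x := Prod.ext rfl ((congrArg (x.2 + ·) (map_zero A.toQuot)).trans (add_zero _))
  s_m _ := rfl
  t_m p := by
    have h : A.strictTarget p.1.1 = A.strictSource p.1.2 := p.2
    have hp : p.1.1.1 = p.1.2.1 := congrArg (fun e : A.objData.Carrier => e.1) h
    have hq : p.1.1.2.1 + A.toQuot p.1.1.2.2 = p.1.2.2.1 := congrArg (fun e : A.objData.Carrier => e.2) h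
    refine Prod.ext hp ?_
    change p.1.1.2.1 + A.toQuot (p.1.1.2.2 + p.1.2.2.2) = p.1.2.2.1 + A.toQuot p.1.2.2.2
    rw [map_add, ← hq, add_assoc]
  i_m _ := Prod.ext rfl (Prod.ext rfl (zero_add _))
  m_i _ := Prod.ext rfl (Prod.ext rfl (add_zero _))
  m_assoc _ _ _ _ _ := Prod.ext rfl (Prod.ext rfl (add_assoc _ _ _))

/-- Arrows with source `0` have no `g`-component, and every term of the bracket involves one. -/
instance isLieAbelian_strict : IsLieAbelian A.strict.crossedModule.h where
  trivial x y := by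
    have hx : A.strictSource x.1 = 0 := (A.strictSource.mem_ker).1 x.2
    have hx₁ : x.1.1 = 0 := congrArg Prod.fst hx
    have hx₂ : x.1.2.1 = 0 := congrArg Prod.snd hx
    have hy : A.strictSource y.1 = 0 := (A.strictSource.mem_ker).1 y.2
    have hy₁ : y.1.1 = 0 := congrArg Prod.fst hy
    have hy₂ : y.1.2.1 = 0 := congrArg Prod.snd hy
    refine Subtype.ext (Prod.ext ?_ (Prod.ext ?_ ?_))
    · change A.br x.1.1 y.1.1 = 0
      rw [hx₁, map_zero, LinearMap.zero_apply]
    · change A.qact x.1.1 y.1.2.1 - A.qact y.1.1 x.1.2.1 + -A.toQuot (A.primitive x.1.1 y.1.1) = 0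
      simp [hx₁, hy₁]
    · change A.iact x.1.1 y.1.2.2 - A.iact y.1.1 x.1.2.2 + 0 = 0
      simp [hx₁, hy₁]

/-! ### The comparison of the two Lie 2-algebras -/

/-- Reduces an identity of arrows with equal sources to one of formal functions, on which
composition is addition. -/
theorem strict_ext {f f' : A.strict.toSemistrict.V.Arr}
    (hs : A.strict.toSemistrict.V.s f = A.strict.toSemistrict.V.s f')
    (h : (f : A.strict.Arr).2.2 = (f' : A.strict.Arr).2.2) : f = f' :=
  Prod.ext (congrArg (fun e : A.objData.Carrier => e.1) hs)
    (Prod.ext (congrArg (fun e : A.objData.Carrier => e.2) hs) h)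

theorem snd_snd_comp_strict (f f' : A.strict.toSemistrict.V.Arr) (h) :
    (A.strict.toSemistrict.V.comp f f' h : A.strict.Arr).2.2 =
      (f : A.strict.Arr).2.2 + (f' : A.strict.Arr).2.2 := rfl

theorem snd_snd_J_strict (x y z : A.strict.Obj) :
    (A.strict.toSemistrict.J x y z : A.strict.Arr).2.2 = 0 := rfl

/-- The comparison map on arrows. -/
noncomputable def toStrictArr : g × V →ₗ[K] g × FunQuot K g V × FormalFun K g V :=
  (LinearMap.fst K g V).prod (LinearMap.inr K (FunQuot K g V) _ ∘ₗ const ∘ₗ LinearMap.snd K g V)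

/-- The compatibility of the comparison map with the brackets. -/
noncomputable def toStrictBr : g →ₗ[K] g →ₗ[K] g × FunQuot K g V × FormalFun K g V :=
  LinearMap.mk₂ K
    (fun x y => (A.br x y, -A.toQuot (A.primitive x y), A.primitive x y))
    (fun _ _ _ => Prod.ext (by simp) (Prod.ext (by simp; abel) (by simp)))
    (fun _ _ _ => Prod.ext (by simp) (Prod.ext (by simp) (by simp)))
    (fun _ _ _ => Prod.ext (by simp) (Prod.ext (by simp; abel) (by simp)))
    (fun _ _ _ => Prod.ext (by simp) (Prod.ext (by simp) (by simp)))

theorem s_toStrictBr (x y : g) : A.strict.s (A.toStrictBr x y) =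
    A.strict.toSemistrict.br₀ (LinearMap.inl K g (FunQuot K g V) x)
      (LinearMap.inl K g (FunQuot K g V) y) :=
  Prod.ext rfl (by
    change -A.toQuot (A.primitive x y) = A.qact x 0 - A.qact y 0 + -A.toQuot (A.primitive x y)
    simp)

/-- The homomorphism from the skeletal Lie `2`-algebra of a `3`-cocycle to its strict Lie
`2`-algebra. -/
noncomputable def skeletalToStrict :
    SemistrictLieTwoAlgebra.Hom A.skeletal A.strict.toSemistrict where
  obj := LinearMap.inl K g (FunQuot K g V)
  arr := toStrictArr
  s_arr _ := rfl
  t_arr _ := Prod.ext rfl ((zero_add _).trans (A.toQuot_const _))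
  arr_i x := Prod.ext rfl (Prod.ext rfl (map_zero const))
  arr_comp f f' h := Prod.ext rfl (Prod.ext rfl (map_add const f.2 f'.2))
  F₂ := A.toStrictBr
  s_F₂ := A.s_toStrictBr
  t_F₂ x y := Prod.ext rfl (neg_add_cancel (A.toQuot (A.primitive x y)))
  F₂_natural f f' := by
    refine A.strict_ext ?_ ?_
    · rw [TwoVectorSpace.s_comp, TwoVectorSpace.s_comp, BracketTwoVectorSpace.s_br]
      exact (A.s_toStrictBr f.1 f'.1).symm
    · change A.iact f.1 (const f'.2) - A.iact f'.1 (const f.2) + 0 + A.primitive f.1 f'.1 =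
        A.primitive f.1 f'.1 + const (A.act f.1 f'.2 - A.act f'.1 f.2)
      rw [iact_const, iact_const, map_sub]
      abel
  F₂_skew (x y : g) := Prod.ext (A.br_skew x y) (Prod.ext (by
    change -A.toQuot (A.primitive x y) = - -A.toQuot (A.primitive y x)
    rw [A.primitive_skew x y, map_neg]) (A.primitive_skew x y))
  F₂_jacobiator (x y z : g) := by
    refine A.strict_ext ?_ ?_
    · rw [TwoVectorSpace.s_comp, TwoVectorSpace.s_comp, TwoVectorSpace.s_comp,
        TwoVectorSpace.s_comp, BracketTwoVectorSpace.s_br, BracketTwoVectorSpace.s_J,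
        TwoVectorSpace.s_i]
      exact congrArg (A.strict.toSemistrict.br₀ · _) (A.s_toStrictBr x y).symm
    · refine (A.snd_snd_comp_strict _ _ _).trans (Eq.trans ?_ (A.snd_snd_comp_strict _ _ _).symm)
      refine (congrArg (· + _) (A.snd_snd_comp_strict _ _ _)).trans
        (Eq.trans ?_ (congrArg (· + _) (A.snd_snd_comp_strict _ _ _)).symm)
      refine (congrArg (· + _ + _) (A.snd_snd_J_strict _ _ _)).trans ?_
      change 0 + ((A.iact x (A.primitive y z) - A.iact (A.br y z) 0 + 0) +
          (A.iact (A.br x z) 0 - A.iact y (A.primitive x z) + 0)) +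
          (A.primitive x (A.br y z) + A.primitive (A.br x z) y) =
        (A.iact (A.br x y) 0 - A.iact z (A.primitive x y) + 0) + A.primitive (A.br x y) z +
          const (A.om x y z)
      -- The strict Jacobiator contributes zero and the skeletal one contributes `const (om x y z)`:
      -- what remains is that `om` is the coboundary of `primitive`.
      have h := A.primitive_equation x y z
      rw [A.primitive_skew z x, A.br_skew z x, A.primitive_skew (A.br y z) x,
        map_neg A.primitive, LinearMap.neg_apply] at h
      simp only [map_zero, map_neg] at h ⊢
      linear_combination (norm := abel) h

end CocycleData
end LieTwo

/-! ### Weak equivalences have weak inverses -/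

namespace LieTwo

namespace BracketTwoVectorSpace

variable {K : Type v} [Field K] (L : BracketTwoVectorSpace.{v, u} K)

/-- The kernels of source and target commute. -/
theorem br_kernels_eq_zero {a b : L.V.Arr} (ha : L.V.s a = 0) (hb : L.V.t b = 0) :
    L.br₁ a b = 0 := by
  -- Interchange law: `a` is `0` followed by `a` and `b` is `b` followed by `0`, so `[a, b]` is `[0,
  -- b]` followed by `[a, 0]`.
  have h := L.br_comp 0 a b 0 (by rw [map_zero, ha]) (by rw [map_zero, hb])
  simpa [TwoVectorSpace.comp_eq, hb] using h

/-- The bracket of arrows with the same source respectively the same target. -/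
theorem br_sub_br {f f' h h' : L.V.Arr} (hf : L.V.s f = L.V.s f') (hh : L.V.t h = L.V.t h') :
    L.br₁ f h - L.br₁ f h' = L.br₁ f' h - L.br₁ f' h' := by
  have := L.br_kernels_eq_zero (a := f - f') (b := h - h') (by rw [map_sub, hf, sub_self])
    (by rw [map_sub, hh, sub_self])
  simp only [map_sub, LinearMap.sub_apply] at this
  linear_combination (norm := abel) this

end BracketTwoVectorSpace

namespace SemistrictLieTwoAlgebra

variable {K : Type v} [Field K]

/-- A `2`-homomorphism is invertible. -/
def TwoHom.toTwoIso {L : SemistrictLieTwoAlgebra.{v, u₁} K} {L' : SemistrictLieTwoAlgebra.{v, u₂} K}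
    {F G : Hom L L'} (τ : TwoHom F G) : TwoIso F G where
  hom := τ
  inv :=
    -- The inverse of an arrow `f` is `i (s f) + i (t f) - f`.
    { θ := L'.V.i ∘ₗ F.obj + L'.V.i ∘ₗ G.obj - τ.θ
      s_θ := fun x => by simp [L'.V.s_i, τ.s_θ]
      t_θ := fun x => by simp [L'.V.t_i, τ.t_θ]
      θ_natural := fun f => by
        have h := τ.θ_natural f
        simp only [TwoVectorSpace.comp_eq, LinearMap.sub_apply, LinearMap.add_apply,
          LinearMap.comp_apply, map_sub, map_add, F.t_arr, G.t_arr, L'.V.t_i, τ.t_θ] at h ⊢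
        linear_combination (norm := abel) -h
      θ_br := fun x y => by
        have h := τ.θ_br x y
        -- The bracket of two inverse arrows contains mixed brackets of an arrow with an identity;
        -- the interchange law, used for both orders, eliminates them.
        have h₁ := L'.br_sub_br (f := τ.θ x) (f' := L'.V.i (F.obj x)) (h := τ.θ y)
          (h' := L'.V.i (G.obj y)) (by rw [τ.s_θ, L'.V.s_i]) (by rw [τ.t_θ, L'.V.t_i])
        have h₃ := L'.br_sub_br (h := τ.θ x) (h' := L'.V.i (G.obj x)) (f := τ.θ y)
          (f' := L'.V.i (F.obj y)) (by rw [τ.s_θ, L'.V.s_i]) (by rw [τ.t_θ, L'.V.t_i])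
        simp only [TwoVectorSpace.comp_eq, LinearMap.sub_apply, LinearMap.add_apply,
          LinearMap.comp_apply, map_sub, map_add, F.t_F₂, G.t_F₂, L'.V.t_i, L'.t_br, τ.t_θ, L'.br_i]
          at h h₁ h₃ ⊢
        rw [L'.br₁_skew (τ.θ y), L'.br₁_skew (τ.θ y), L'.br₁_skew (L'.V.i (F.obj y)),
          L'.br₀_skew (F.obj y)] at h₃
        simp only [map_neg] at h₃
        linear_combination (norm := abel) -h - h₁ + h₃ }
  hom_inv x := by
    simp only [TwoVectorSpace.comp_eq, LinearMap.sub_apply, LinearMap.add_apply,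
      LinearMap.comp_apply, τ.t_θ]
    abel
  inv_hom x := by
    simp only [TwoVectorSpace.comp_eq, LinearMap.sub_apply, LinearMap.add_apply,
      LinearMap.comp_apply, map_sub, map_add, L'.V.t_i, τ.t_θ]
    abel

variable {L : SemistrictLieTwoAlgebra.{v, u₁} K} {L' : SemistrictLieTwoAlgebra.{v, u₂} K}

/-- A homomorphism is a weak equivalence if its underlying linear functor is fully faithful and
essentially surjective. -/
structure Hom.IsWeakEquiv (F : Hom L L') : Prop where
  ess_surj : ∀ x', ∃ x f, L'.V.s f = F.obj x ∧ L'.V.t f = x'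
  faithful : ∀ f, L.V.s f = 0 → L.V.t f = 0 → F.arr f = 0 → f = 0
  full : ∀ x y f', L'.V.s f' = F.obj x → L'.V.t f' = F.obj y →
    ∃ f, L.V.s f = x ∧ L.V.t f = y ∧ F.arr f = f'

theorem Hom.IsWeakEquiv.comp {L'' : SemistrictLieTwoAlgebra.{v, u₃} K} {F : Hom L L'}
    {G : Hom L' L''} (hF : F.IsWeakEquiv) (hG : G.IsWeakEquiv) : (F.comp G).IsWeakEquiv where
  ess_surj z := by
    obtain ⟨y, f, hs, ht⟩ := hG.ess_surj z
    obtain ⟨x, e, hs', ht'⟩ := hF.ess_surj y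
    refine ⟨x, L''.V.comp (G.arr e) f (by rw [G.t_arr, ht', hs]), ?_, ?_⟩
    · rw [TwoVectorSpace.s_comp, G.s_arr, hs']; rfl
    · rw [TwoVectorSpace.t_comp, ht]
  faithful f hs ht h :=
    hF.faithful f hs ht (hG.faithful _ (by rw [F.s_arr, hs, map_zero])
      (by rw [F.t_arr, ht, map_zero]) h)
  full x y f hs ht := by
    obtain ⟨f', hs', ht', rfl⟩ := hG.full (F.obj x) (F.obj y) f hs ht
    obtain ⟨f'', hs'', ht'', rfl⟩ := hF.full x y f' hs' ht'
    exact ⟨f'', hs'', ht'', rfl⟩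

/-- Linear choices from which a weak inverse is constructed: a preimage up to isomorphism of each
object, and a preimage of each arrow between images. -/
structure Hom.InverseData (F : Hom L L') where
  obj : L'.V.Obj →ₗ[K] L.V.Obj
  ε : L'.V.Obj →ₗ[K] L'.V.Arr
  s_ε : ∀ x, L'.V.s (ε x) = F.obj (obj x)
  t_ε : ∀ x, L'.V.t (ε x) = x
  lift : L.V.Obj × L.V.Obj × L'.V.Arr →ₗ[K] L.V.Arr
  s_lift : ∀ x y f, L'.V.s f = F.obj x → L'.V.t f = F.obj y → L.V.s (lift (x, y, f)) = x
  t_lift : ∀ x y f, L'.V.s f = F.obj x → L'.V.t f = F.obj y → L.V.t (lift (x, y, f)) = y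
  arr_lift : ∀ x y f, L'.V.s f = F.obj x → L'.V.t f = F.obj y → F.arr (lift (x, y, f)) = f
  ext : ∀ f f', L.V.s f = L.V.s f' → L.V.t f = L.V.t f' → F.arr f = F.arr f' → f = f'

/-- Surjective linear maps have linear sections and injective ones linear retractions, so both
choices can be made linearly. -/
theorem Hom.IsWeakEquiv.nonempty_inverseData {F : Hom L L'} (hF : F.IsWeakEquiv) :
    Nonempty F.InverseData := by
  let P : Submodule K (L.V.Obj × L'.V.Arr) :=
    LinearMap.eqLocus (F.obj ∘ₗ LinearMap.fst K _ _) (L'.V.s ∘ₗ LinearMap.snd K _ _)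
  obtain ⟨σ, hσ⟩ := (L'.V.t ∘ₗ LinearMap.snd K _ _ ∘ₗ P.subtype).exists_rightInverse_of_surjective
    (LinearMap.range_eq_top.2 fun x' => by
      obtain ⟨x, f, hs, ht⟩ := hF.ess_surj x'
      exact ⟨⟨(x, f), hs.symm⟩, ht⟩)
  have hext : ∀ f f', L.V.s f = L.V.s f' → L.V.t f = L.V.t f' → F.arr f = F.arr f' → f = f' :=
    fun f f' hs ht h => sub_eq_zero.1 (hF.faithful (f - f') (by rw [map_sub, hs, sub_self])
      (by rw [map_sub, ht, sub_self]) (by rw [map_sub, h, sub_self]))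
  -- Faithfulness makes this map injective. Its retraction is defined on all triples, but is
  -- meaningful only on its image, which by fullness contains every compatible triple.
  obtain ⟨Λ, hΛ⟩ := (L.V.s.prod (L.V.t.prod F.arr)).exists_leftInverse_of_injective
    (LinearMap.ker_eq_bot.2 fun f f' h => hext f f' (congrArg Prod.fst h)
      (congrArg (fun p => p.2.1) h) (congrArg (fun p => p.2.2) h))
  have hΛ' (f) : Λ (L.V.s f, L.V.t f, F.arr f) = f := LinearMap.congr_fun hΛ f
  refine ⟨⟨LinearMap.fst K _ _ ∘ₗ P.subtype ∘ₗ σ, LinearMap.snd K _ _ ∘ₗ P.subtype ∘ₗ σ,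
    fun x => (σ x).2.symm, fun x => LinearMap.congr_fun hσ x, Λ, ?_, ?_, ?_, hext⟩⟩ <;>
  · rintro x y f hs ht
    obtain ⟨f, rfl, rfl, rfl⟩ := hF.full x y f hs ht
    rw [hΛ']

namespace Hom.InverseData

variable {F : Hom L L'} (I : F.InverseData)

/-- Conjugation of an arrow with the chosen isomorphisms. -/
def conj : L'.V.Arr →ₗ[K] L'.V.Arr :=
  -- The composite of `ε (s f)`, `f` and the inverse of `ε (t f)`, expanded by
  -- `TwoVectorSpace.comp_eq`.
  I.ε ∘ₗ L'.V.s + LinearMap.id - I.ε ∘ₗ L'.V.t - L'.V.i ∘ₗ L'.V.s +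
    L'.V.i ∘ₗ F.obj ∘ₗ I.obj ∘ₗ L'.V.t

theorem conj_apply (f : L'.V.Arr) : I.conj f = I.ε (L'.V.s f) + f - I.ε (L'.V.t f) -
    L'.V.i (L'.V.s f) + L'.V.i (F.obj (I.obj (L'.V.t f))) := rfl

theorem s_conj (f : L'.V.Arr) : L'.V.s (I.conj f) = F.obj (I.obj (L'.V.s f)) := by
  simp only [conj_apply, map_add, map_sub, I.s_ε, L'.V.s_i]; abel

theorem t_conj (f : L'.V.Arr) : L'.V.t (I.conj f) = F.obj (I.obj (L'.V.t f)) := by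
  simp only [conj_apply, map_add, map_sub, I.t_ε, L'.V.t_i]; abel

/-- The inverse functor on arrows. -/
def arr : L'.V.Arr →ₗ[K] L.V.Arr :=
  I.lift ∘ₗ (I.obj ∘ₗ L'.V.s).prod ((I.obj ∘ₗ L'.V.t).prod I.conj)

theorem s_arr (f : L'.V.Arr) : L.V.s (I.arr f) = I.obj (L'.V.s f) :=
  I.s_lift _ _ _ (I.s_conj f) (I.t_conj f)

theorem t_arr (f : L'.V.Arr) : L.V.t (I.arr f) = I.obj (L'.V.t f) :=
  I.t_lift _ _ _ (I.s_conj f) (I.t_conj f)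

theorem arr_arr (f : L'.V.Arr) : F.arr (I.arr f) = I.conj f :=
  I.arr_lift _ _ _ (I.s_conj f) (I.t_conj f)

/-- The image under `F` of the compatibility of the inverse functor with the brackets. -/
def preBr : L'.V.Obj →ₗ[K] L'.V.Obj →ₗ[K] L'.V.Arr :=
  -- The composite of the inverse of `F₂`, the bracket of the two arrows `ε`, and the inverse of `ε`
  -- at the bracket.
  (L.br₀.compl₁₂ I.obj I.obj).compr₂ (L'.V.i ∘ₗ F.obj) - F.F₂.compl₁₂ I.obj I.obj +
    L'.br₁.compl₁₂ I.ε I.ε + L'.br₀.compr₂ (L'.V.i ∘ₗ F.obj ∘ₗ I.obj - I.ε)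

theorem preBr_apply (x y : L'.V.Obj) : I.preBr x y =
    L'.V.i (F.obj (L.br₀ (I.obj x) (I.obj y))) - F.F₂ (I.obj x) (I.obj y) +
      L'.br₁ (I.ε x) (I.ε y) + (L'.V.i (F.obj (I.obj (L'.br₀ x y))) - I.ε (L'.br₀ x y)) := rfl

theorem s_preBr (x y : L'.V.Obj) :
    L'.V.s (I.preBr x y) = F.obj (L.br₀ (I.obj x) (I.obj y)) := by
  simp only [preBr_apply, map_add, map_sub, I.s_ε, L'.V.s_i, L'.s_br, F.s_F₂]; abel

theorem t_preBr (x y : L'.V.Obj) :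
    L'.V.t (I.preBr x y) = F.obj (I.obj (L'.br₀ x y)) := by
  simp only [preBr_apply, map_add, map_sub, I.t_ε, L'.V.t_i, L'.t_br, F.t_F₂]; abel

/-- The compatibility of the inverse functor with the brackets. -/
def F₂ : L'.V.Obj →ₗ[K] L'.V.Obj →ₗ[K] L.V.Arr :=
  LinearMap.mk₂ K
    (fun x y => I.lift (L.br₀ (I.obj x) (I.obj y), I.obj (L'.br₀ x y), I.preBr x y))
    (fun x x' y => by rw [← map_add]; simp)
    (fun c x y => by rw [← map_smul]; simp)
    (fun x y y' => by rw [← map_add]; simp)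
    (fun c x y => by rw [← map_smul]; simp)

theorem s_F₂ (x y : L'.V.Obj) : L.V.s (I.F₂ x y) = L.br₀ (I.obj x) (I.obj y) :=
  I.s_lift _ _ _ (I.s_preBr x y) (I.t_preBr x y)

theorem t_F₂ (x y : L'.V.Obj) : L.V.t (I.F₂ x y) = I.obj (L'.br₀ x y) :=
  I.t_lift _ _ _ (I.s_preBr x y) (I.t_preBr x y)

theorem arr_F₂ (x y : L'.V.Obj) : F.arr (I.F₂ x y) = I.preBr x y :=
  I.arr_lift _ _ _ (I.s_preBr x y) (I.t_preBr x y)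

/-- The image under `F` of the bracket of two arrows. -/
theorem arr_br (F : Hom L L') (f h : L.V.Arr) : F.arr (L.br₁ f h) =
    L'.br₁ (F.arr f) (F.arr h) + F.F₂ (L.V.t f) (L.V.t h) - F.F₂ (L.V.s f) (L.V.s h) -
      L'.V.i (L'.br₀ (F.obj (L.V.t f)) (F.obj (L.V.t h))) + L'.V.i (F.obj (L.br₀ (L.V.s f) (L.V.s h))) := by
  have h := F.F₂_natural f h
  simp only [TwoVectorSpace.comp_eq, L'.t_br, F.t_arr, F.t_F₂] at h
  linear_combination (norm := abel) -h

theorem br_conj (f h : L'.V.Arr) : L'.br₁ (I.conj f) (I.conj h) =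
    L'.br₁ (I.ε (L'.V.s f)) (I.ε (L'.V.s h)) + L'.br₁ f h -
      L'.br₁ (I.ε (L'.V.t f)) (I.ε (L'.V.t h)) - L'.V.i (L'.br₀ (L'.V.s f) (L'.V.s h)) +
      L'.V.i (L'.br₀ (F.obj (I.obj (L'.V.t f))) (F.obj (I.obj (L'.V.t h)))) := by
  have h₁ := L'.br_comp (I.conj f) (I.ε (L'.V.t f)) (I.conj h) (I.ε (L'.V.t h))
    (by rw [t_conj, s_ε]) (by rw [t_conj, s_ε])
  have h₂ := L'.br_comp (I.ε (L'.V.s f)) f (I.ε (L'.V.s h)) h (I.t_ε _) (I.t_ε _)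
  have e (f) : L'.V.comp (I.conj f) (I.ε (L'.V.t f)) (by rw [t_conj, s_ε]) =
      L'.V.comp (I.ε (L'.V.s f)) f (I.t_ε _) := by
    rw [TwoVectorSpace.comp_eq, TwoVectorSpace.comp_eq, t_conj, conj_apply, t_ε]; abel
  rw [e, e, h₂] at h₁
  simp only [TwoVectorSpace.comp_eq, L'.t_br, t_conj, t_ε] at h₁
  linear_combination (norm := abel) -h₁

/-- The inverse homomorphism. -/
def inverse : Hom L' L where
  obj := I.obj
  arr := I.arr
  s_arr := I.s_arr
  t_arr := I.t_arr
  -- This and the following identities are checked on source, target and image under `F`, since `F`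
  -- is faithful.
  arr_i x := I.ext _ _ (by rw [s_arr, L'.V.s_i, L.V.s_i]) (by rw [t_arr, L'.V.t_i, L.V.t_i]) (by
    rw [arr_arr, conj_apply, L'.V.s_i, L'.V.t_i, F.arr_i]; abel)
  arr_comp f h hfh := I.ext _ _ (by simp only [s_arr, TwoVectorSpace.s_comp])
    (by simp only [t_arr, TwoVectorSpace.t_comp]) (by
    rw [F.arr_comp]
    simp only [arr_arr, TwoVectorSpace.comp_eq, conj_apply, map_add, map_sub, L'.V.s_i, L'.V.t_i, hfh,
      t_ε]
    abel)
  F₂ := I.F₂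
  s_F₂ := I.s_F₂
  t_F₂ := I.t_F₂
  F₂_natural f h := I.ext _ _
    (by simp only [TwoVectorSpace.s_comp, L.s_br, s_arr, s_F₂])
    (by simp only [TwoVectorSpace.t_comp, L'.t_br, t_arr, t_F₂]) (by
    simp only [TwoVectorSpace.comp_eq, L.t_br, t_arr, t_F₂]
    simp only [map_add, map_sub, F.arr_i, arr_arr, arr_br, s_arr, t_arr, br_conj, arr_F₂]
    simp only [conj_apply, preBr_apply, L'.s_br, L'.t_br]
    abel)
  F₂_skew x y := I.ext _ _
    (by simp only [map_neg, s_F₂]; exact L.br₀_skew _ _)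
    (by simp only [map_neg, t_F₂]; rw [L'.br₀_skew, map_neg]) (by
    simp only [map_neg, arr_F₂, preBr_apply]
    rw [L'.br₁_skew, L.br₀_skew, F.F₂_skew, L'.br₀_skew]
    simp only [map_neg]
    abel)
  F₂_jacobiator x y z := I.ext _ _
    (by simp only [TwoVectorSpace.s_comp, L.s_br, L.s_J, s_F₂, L.V.s_i])
    (by simp only [TwoVectorSpace.t_comp, t_arr, L'.t_J, map_add, t_F₂]) (by
    simp only [TwoVectorSpace.comp_eq, L.t_br, t_F₂, map_add, L.t_J, L.V.t_i]
    simp only [map_add, map_sub, arr_arr, arr_br, arr_F₂, s_F₂, t_F₂, L.V.s_i,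
      L.V.t_i, F.arr_i]
    simp only [conj_apply, preBr_apply, L'.s_J, L'.t_J, map_add, map_sub, LinearMap.add_apply,
      LinearMap.sub_apply, L'.br_i]
    have h₁ := F.F₂_jacobiator (I.obj x) (I.obj y) (I.obj z)
    have h₂ := L'.J_natural (I.ε x) (I.ε y) (I.ε z)
    -- `h₁` transports the Jacobiator through `F` and `h₂` along the arrows `ε`. The interchange law
    -- then accounts for the nested brackets of `ε`, once for each variable.
    have h₃ := L'.br_sub_br (f := I.ε x) (f' := L'.V.i (F.obj (I.obj x)))
      (h := L'.br₁ (I.ε y) (I.ε z)) (h' := I.ε (L'.br₀ y z)) (by rw [s_ε, L'.V.s_i])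
      (by rw [L'.t_br, t_ε, t_ε, t_ε])
    have h₄ := L'.br_sub_br (f := I.ε y) (f' := L'.V.i (F.obj (I.obj y)))
      (h := L'.br₁ (I.ε x) (I.ε z)) (h' := I.ε (L'.br₀ x z)) (by rw [s_ε, L'.V.s_i])
      (by rw [L'.t_br, t_ε, t_ε, t_ε])
    have h₅ := L'.br_sub_br (f := I.ε z) (f' := L'.V.i (F.obj (I.obj z)))
      (h := L'.br₁ (I.ε x) (I.ε y)) (h' := I.ε (L'.br₀ x y)) (by rw [s_ε, L'.V.s_i])
      (by rw [L'.t_br, t_ε, t_ε, t_ε])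
    simp only [TwoVectorSpace.comp_eq, L'.t_J, map_add, L'.t_br, F.t_F₂, L'.V.t_i, I.s_ε, I.t_ε]
      at h₁ h₂
    simp only [L'.br₁_skew (I.ε y) (L'.br₁ (I.ε x) (I.ε z)), L'.br₁_skew (I.ε y) (I.ε (L'.br₀ x z)),
      L'.br₁_skew (L'.V.i (F.obj (I.obj y))) (L'.br₁ (I.ε x) (I.ε z)),
      L'.br₁_skew (L'.V.i (F.obj (I.obj y))) (I.ε (L'.br₀ x z))] at h₄
    simp only [L'.br₁_skew (I.ε z) (L'.br₁ (I.ε x) (I.ε y)), L'.br₁_skew (I.ε z) (I.ε (L'.br₀ x y)),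
      L'.br₁_skew (L'.V.i (F.obj (I.obj z))) (L'.br₁ (I.ε x) (I.ε y)),
      L'.br₁_skew (L'.V.i (F.obj (I.obj z))) (I.ε (L'.br₀ x y))] at h₅
    simp only [map_add, map_sub, L'.t_br, L'.t_J, F.t_F₂, L.t_br, L.t_J, L.V.t_i,
      L'.V.t_i, t_F₂] at h₁ h₂ ⊢
    linear_combination (norm := abel) -h₁ - h₂ - h₃ + h₄ - h₅)

/-- The isomorphisms from the values of the composite on `L` to the identity. -/
def unit : L.V.Obj →ₗ[K] L.V.Arr :=
  I.lift ∘ₗ (I.obj ∘ₗ F.obj).prod (LinearMap.id.prod (I.ε ∘ₗ F.obj))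

theorem s_unit (x : L.V.Obj) : L.V.s (I.unit x) = I.obj (F.obj x) :=
  I.s_lift _ _ _ (I.s_ε _) (I.t_ε _)

theorem t_unit (x : L.V.Obj) : L.V.t (I.unit x) = x :=
  I.t_lift _ _ _ (I.s_ε _) (I.t_ε _)

theorem arr_unit (x : L.V.Obj) : F.arr (I.unit x) = I.ε (F.obj x) :=
  I.arr_lift _ _ _ (I.s_ε _) (I.t_ε _)

/-- The composite of `F` with the inverse homomorphism is isomorphic to the identity. -/
def compInverse : TwoHom (F.comp I.inverse) (Hom.id L) where
  θ := I.unit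
  s_θ := I.s_unit
  t_θ := I.t_unit
  θ_natural f := I.ext _ _ (by
      simp only [TwoVectorSpace.s_comp, s_unit]; exact (I.s_arr _).trans (by rw [F.s_arr]))
    (by simp only [TwoVectorSpace.t_comp, t_unit]; rfl) (by
    simp only [TwoVectorSpace.comp_eq, map_add, map_sub, F.arr_i, arr_unit, t_unit]
    change F.arr (I.arr (F.arr f)) + _ - L'.V.i (F.obj (L.V.t (I.arr (F.arr f)))) =
      I.ε (F.obj (L.V.s f)) + F.arr f - _
    rw [arr_arr, conj_apply, t_arr, F.s_arr, F.t_arr]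
    abel)
  θ_br x y := I.ext _ _ (by
      simp only [TwoVectorSpace.s_comp, L.s_br, s_unit]
      exact (F.comp I.inverse).s_F₂ x y)
    (by simp only [TwoVectorSpace.t_comp, t_unit]; exact (L.V.t_i _).symm) (by
    simp only [TwoVectorSpace.comp_eq, map_add, map_sub, F.arr_i, arr_unit, arr_br, s_unit, t_unit,
      L.t_br]
    have e₁ : (F.comp I.inverse).F₂ x y = I.F₂ (F.obj x) (F.obj y) + I.arr (F.F₂ x y) -
      L.V.i (L.V.t (I.F₂ (F.obj x) (F.obj y))) := TwoVectorSpace.comp_eq _ _ _ _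
    have e₂ : (Hom.id L).F₂ x y = L.V.i (L.br₀ x y) := rfl
    rw [e₁, e₂]
    simp only [map_add, map_sub, F.arr_i, L.V.t_i, arr_arr, arr_F₂, preBr_apply, conj_apply, t_arr,
      t_F₂, F.s_F₂, F.t_F₂]
    abel)

/-- The composite of the inverse homomorphism with `F` is isomorphic to the identity. -/
def inverseComp : TwoHom (I.inverse.comp F) (Hom.id L') where
  θ := I.ε
  s_θ := I.s_ε
  t_θ := I.t_ε
  θ_natural f := by
    simp only [TwoVectorSpace.comp_eq, t_ε]
    change F.arr (I.arr f) + _ - L'.V.i (L'.V.t (F.arr (I.arr f))) = _ + f - _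
    rw [F.t_arr, t_arr, arr_arr, conj_apply]
    abel
  θ_br x y := by
    simp only [TwoVectorSpace.comp_eq, t_ε, L'.t_br]
    have e₁ : (I.inverse.comp F).F₂ x y = F.F₂ (I.obj x) (I.obj y) + F.arr (I.F₂ x y) -
      L'.V.i (L'.V.t (F.F₂ (I.obj x) (I.obj y))) := TwoVectorSpace.comp_eq _ _ _ _
    have e₂ : (Hom.id L').F₂ x y = L'.V.i (L'.br₀ x y) := rfl
    rw [e₁, e₂]
    simp only [map_add, map_sub, F.t_F₂, L'.V.t_i, arr_F₂, preBr_apply, I.t_ε, L'.t_br]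
    abel

/-- Conjugation with isomorphisms loses nothing: on an arrow from `0` to `0` it is the identity,
which gives faithfulness, and it can be undone for fullness. -/
theorem isWeakEquiv_inverse : I.inverse.IsWeakEquiv where
  ess_surj x := ⟨F.obj x, I.unit x, I.s_unit x, I.t_unit x⟩
  faithful f hs ht h := by
    have h' := I.conj_apply f
    rw [← arr_arr, show I.arr f = 0 from h, hs, ht] at h'
    simpa using h'.symm
  full x y f hs ht := by
    -- The preimage of `f` is the inverse of `ε x`, then `F f`, then `ε y`.
    have hs' : L'.V.s (L'.V.i x - I.ε x + F.arr f - L'.V.i (F.obj (I.obj y)) + I.ε y) = x := by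
      simp only [map_add, map_sub, s_ε, L'.V.s_i, F.s_arr, hs]
      change x - _ + F.obj (I.obj x) - _ + _ = x
      abel
    have ht' : L'.V.t (L'.V.i x - I.ε x + F.arr f - L'.V.i (F.obj (I.obj y)) + I.ε y) = y := by
      simp only [map_add, map_sub, t_ε, L'.V.t_i, F.t_arr, ht]
      change x - _ + F.obj (I.obj y) - _ + _ = y
      abel
    refine ⟨_, hs', ht', I.ext _ _ ((I.s_arr _).trans ?_) ((I.t_arr _).trans ?_) ?_⟩
    · rw [hs', hs]; rfl
    · rw [ht', ht]; rfl
    · refine (I.arr_arr _).trans ?_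
      rw [conj_apply, hs', ht']
      abel

end Hom.InverseData

/-- A weak equivalence is an equivalence, and its inverse is again a weak equivalence. -/
theorem Hom.IsWeakEquiv.exists_inverse {F : Hom L L'} (hF : F.IsWeakEquiv) :
    ∃ G : Hom L' L, G.IsWeakEquiv ∧ Nonempty (TwoIso (F.comp G) (Hom.id L)) ∧
      Nonempty (TwoIso (G.comp F) (Hom.id L')) := by
  obtain ⟨I⟩ := hF.nonempty_inverseData
  exact ⟨I.inverse, I.isWeakEquiv_inverse, ⟨I.compInverse.toTwoIso⟩, ⟨I.inverseComp.toTwoIso⟩⟩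

theorem Hom.IsWeakEquiv.equivalent {F : Hom L L'} (hF : F.IsWeakEquiv) : Equivalent L L' :=
  let ⟨G, _, h⟩ := hF.exists_inverse
  ⟨F, G, h⟩

end SemistrictLieTwoAlgebra
end LieTwo

/-! ### Arrow parts of the Jacobiator and the skeletal model -/

namespace LieTwo

namespace BracketTwoVectorSpace

variable {K : Type v} [Field K] (L : BracketTwoVectorSpace.{v, u} K)

theorem br_eq_of_s_eq_zero {a : L.V.Arr} (ha : L.V.s a = 0) (b : L.V.Arr) :
    L.br₁ a b = L.br₁ a (L.V.i (L.V.t b)) := by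
  rw [← sub_eq_zero, ← map_sub]
  exact L.br_kernels_eq_zero ha (by rw [map_sub, L.V.t_i, sub_self])

/-- Bracketing an arrow with an identity arrow. -/
def whisker : L.V.Obj →ₗ[K] L.V.Arr →ₗ[K] L.V.Arr := L.br₁ ∘ₗ L.V.i

theorem whisker_apply (x : L.V.Obj) (a : L.V.Arr) : L.whisker x a = L.br₁ (L.V.i x) a := rfl

theorem br_i_right (a : L.V.Arr) (x : L.V.Obj) : L.br₁ a (L.V.i x) = -L.whisker x a :=
  L.br₁_skew _ _

theorem whisker_i (x y : L.V.Obj) : L.whisker x (L.V.i y) = L.V.i (L.br₀ x y) := L.br_i x y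

theorem s_whisker (x : L.V.Obj) (a : L.V.Arr) : L.V.s (L.whisker x a) = L.br₀ x (L.V.s a) := by
  rw [whisker_apply, L.s_br, L.V.s_i]

theorem t_whisker (x : L.V.Obj) (a : L.V.Arr) : L.V.t (L.whisker x a) = L.br₀ x (L.V.t a) := by
  rw [whisker_apply, L.t_br, L.V.t_i]

/-- Both sides equal `[a, b]`: on arrows with source `0` the bracket depends on either argument only
through its target. This is the Peiffer identity up to homotopy. -/
theorem whisker_t_skew {a b : L.V.Arr} (ha : L.V.s a = 0) (hb : L.V.s b = 0) :
    L.whisker (L.V.t a) b = -L.whisker (L.V.t b) a := by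
  rw [whisker_apply, L.br₁_skew, ← L.br_eq_of_s_eq_zero hb, L.br₁_skew, L.br_eq_of_s_eq_zero ha,
    br_i_right, neg_neg]

/-- The arrow part of the Jacobiator. -/
def jac : L.V.Obj →ₗ[K] L.V.Obj →ₗ[K] L.V.Obj →ₗ[K] L.V.Arr :=
  L.J - L.br₀.compr₂ (L.br₀.compr₂ L.V.i)

theorem jac_apply (x y z : L.V.Obj) :
    L.jac x y z = L.J x y z - L.V.i (L.br₀ (L.br₀ x y) z) := rfl

theorem J_eq (x y z : L.V.Obj) : L.J x y z = L.V.i (L.br₀ (L.br₀ x y) z) + L.jac x y z := by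
  rw [jac_apply]; abel

theorem s_jac (x y z : L.V.Obj) : L.V.s (L.jac x y z) = 0 := by
  rw [jac_apply, map_sub, L.s_J, L.V.s_i, sub_self]

theorem t_jac (x y z : L.V.Obj) : L.V.t (L.jac x y z) =
    L.br₀ x (L.br₀ y z) + L.br₀ (L.br₀ x z) y - L.br₀ (L.br₀ x y) z := by
  rw [jac_apply, map_sub, L.t_J, L.V.t_i]

theorem jac_swap_left (x y z : L.V.Obj) : L.jac y x z = -L.jac x y z := by
  have h := L.J_antisymm_left x y z
  rw [TwoVectorSpace.arrowPart, TwoVectorSpace.arrowPart, L.s_J, L.s_J] at h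
  exact h

theorem jac_swap_right (x y z : L.V.Obj) : L.jac x z y = -L.jac x y z := by
  have h := L.J_antisymm_right x y z
  rw [TwoVectorSpace.arrowPart, TwoVectorSpace.arrowPart, L.s_J, L.s_J] at h
  exact h

/-- The arrow part of the Jacobiator at the target of an arrow with source `0`. -/
theorem jac_t {a : L.V.Arr} (ha : L.V.s a = 0) (y z : L.V.Obj) : L.jac (L.V.t a) y z =
    L.whisker y (L.whisker z a) - L.whisker z (L.whisker y a) - L.whisker (L.br₀ y z) a := by
  -- Naturality along `a` and two identities; the Jacobiator at the source vanishes because the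
  -- source is `0`.
  have h := L.J_natural a (L.V.i y) (L.V.i z)
  simp only [TwoVectorSpace.comp_eq, L.br_i, br_i_right, L.V.t_i, L.V.s_i, ha, map_zero,
    LinearMap.zero_apply, map_neg, LinearMap.neg_apply, J_eq, neg_neg, t_whisker] at h
  rw [L.br₀_skew (L.V.t a) y, map_neg, LinearMap.neg_apply, L.br₀_skew _ z] at h
  simp only [map_neg] at h
  linear_combination (norm := abel) h

theorem jac_t_mid {a : L.V.Arr} (ha : L.V.s a = 0) (x z : L.V.Obj) : L.jac x (L.V.t a) z =
    L.whisker z (L.whisker x a) - L.whisker x (L.whisker z a) + L.whisker (L.br₀ x z) a := by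
  rw [jac_swap_left, L.jac_t ha]; abel

theorem jac_t_right {a : L.V.Arr} (ha : L.V.s a = 0) (x y : L.V.Obj) : L.jac x y (L.V.t a) =
    L.whisker x (L.whisker y a) - L.whisker y (L.whisker x a) - L.whisker (L.br₀ x y) a := by
  rw [jac_swap_right, L.jac_t_mid ha]; abel

end BracketTwoVectorSpace

namespace SemistrictLieTwoAlgebra

variable {K : Type v} [Field K] (L : SemistrictLieTwoAlgebra.{v, u} K)

/-- The Jacobiator identity in terms of arrow parts. -/
theorem jac_identity (w x y z : L.V.Obj) :
    L.jac (L.br₀ w x) y z - L.whisker y (L.jac w x z) + L.jac w (L.br₀ x z) y +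
        L.jac (L.br₀ w z) x y + L.jac w x (L.br₀ y z) =
      -L.whisker z (L.jac w x y) + L.jac (L.br₀ w y) x z + L.jac w (L.br₀ x y) z -
        L.whisker x (L.jac w y z) + L.whisker w (L.jac x y z) := by
  have h := L.jacobiator_identity w x y z
  simp only [BracketTwoVectorSpace.jacobiatorLeft, BracketTwoVectorSpace.jacobiatorRight,
    TwoVectorSpace.comp_eq] at h
  simp only [L.J_eq, map_add, LinearMap.add_apply, L.br_i, L.br_i_right, ← L.whisker_apply,
    L.whisker_i, L.V.t_i, L.t_jac, map_neg, map_sub, L.t_whisker, L.br₀_skew x (L.br₀ _ _),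
    L.br₀_skew y (L.br₀ _ _), L.br₀_skew z (L.br₀ _ _)] at h
  linear_combination (norm := abel) h

/-- Linear choices from which a skeletal model is constructed: the spaces `H` of isomorphism
classes of objects and `V` of automorphisms of `0`, representatives, and arrows from `0` to the
objects isomorphic to `0`. -/
structure SkeletonData (L : SemistrictLieTwoAlgebra.{v, u₁} K) (H V : Type u₂) [AddCommGroup H]
    [Module K H] [AddCommGroup V] [Module K V] where
  π : L.V.Obj →ₗ[K] H
  σ : H →ₗ[K] L.V.Obj
  π_σ : ∀ x, π (σ x) = x
  π_t : ∀ a, L.V.s a = 0 → π (L.V.t a) = 0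
  lift : L.V.Obj →ₗ[K] L.V.Arr
  s_lift : ∀ x, L.V.s (lift x) = 0
  t_lift : ∀ x, π x = 0 → L.V.t (lift x) = x
  ι : V →ₗ[K] L.V.Arr
  s_ι : ∀ v, L.V.s (ι v) = 0
  t_ι : ∀ v, L.V.t (ι v) = 0
  κ : L.V.Arr →ₗ[K] V
  κ_ι : ∀ v, κ (ι v) = v
  ι_κ : ∀ a, L.V.s a = 0 → L.V.t a = 0 → ι (κ a) = a

/-- Objects are isomorphic when they differ by the target of an arrow out of `0`; linear sections
and retractions provide the rest. The `ULift` places both spaces in the universe `max u v`. -/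
theorem nonempty_skeletonData (L : SemistrictLieTwoAlgebra.{v, u} K) :
    ∃ (H V : Type max u v) (_ : AddCommGroup H) (_ : Module K H) (_ : AddCommGroup V)
      (_ : Module K V), Nonempty (SkeletonData L H V) := by
  let p : LinearMap.ker L.V.s →ₗ[K] L.V.Obj := L.V.t ∘ₗ (LinearMap.ker L.V.s).subtype
  let Z : Submodule K L.V.Arr := LinearMap.ker L.V.s ⊓ LinearMap.ker L.V.t
  let π : L.V.Obj →ₗ[K] ULift.{max u v} (L.V.Obj ⧸ LinearMap.range p) :=
    ULift.moduleEquiv.symm.toLinearMap ∘ₗ (LinearMap.range p).mkQ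
  let ι : ULift.{max u v} Z →ₗ[K] L.V.Arr := Z.subtype ∘ₗ ULift.moduleEquiv.toLinearMap
  have hπ (x) : π x = 0 ↔ x ∈ LinearMap.range p := by
    rw [← Submodule.Quotient.mk_eq_zero]
    exact (ULift.moduleEquiv (R := K)).symm.map_eq_zero_iff
  obtain ⟨σ, hσ⟩ := π.exists_rightInverse_of_surjective (LinearMap.range_eq_top.2
    (ULift.moduleEquiv.symm.surjective.comp (Submodule.mkQ_surjective _)))
  obtain ⟨κ, hκ⟩ := ι.exists_leftInverse_of_injective (LinearMap.ker_eq_bot.2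
    (Subtype.val_injective.comp ULift.moduleEquiv.injective))
  -- A section over the objects isomorphic to `0`, then extended linearly, with arbitrary values, to
  -- all objects.
  obtain ⟨q, hq⟩ := p.rangeRestrict.exists_rightInverse_of_surjective p.range_rangeRestrict
  obtain ⟨r, hr⟩ := q.exists_extend
  refine ⟨_, _, inferInstance, inferInstance, inferInstance, inferInstance,
    ⟨π, σ, LinearMap.congr_fun hσ, fun a ha => (hπ _).2 ⟨⟨a, ha⟩, rfl⟩,
      (LinearMap.ker L.V.s).subtype ∘ₗ r, fun x => (r x).2, fun x hx => ?_, ι, fun v => v.down.2.1,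
      fun v => v.down.2.2, κ, LinearMap.congr_fun hκ, fun a hs ht => ?_⟩⟩
  · have h₁ := LinearMap.congr_fun hr ⟨x, (hπ x).1 hx⟩
    have h₂ := congrArg Subtype.val (LinearMap.congr_fun hq ⟨x, (hπ x).1 hx⟩)
    exact (congrArg (fun a : LinearMap.ker L.V.s => L.V.t a) h₁).trans h₂
  · exact congrArg ι (LinearMap.congr_fun hκ ⟨⟨a, hs, ht⟩⟩)

namespace SkeletonData

variable {L : SemistrictLieTwoAlgebra.{v, u₁} K} {H V : Type u₂} [AddCommGroup H]
    [Module K H] [AddCommGroup V] [Module K V] (S : SkeletonData L H V)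

theorem π_t_eq (a : L.V.Arr) : S.π (L.V.t a) = S.π (L.V.s a) := by
  have h := S.π_t (a - L.V.i (L.V.s a)) (by rw [map_sub, L.V.s_i, sub_self])
  rwa [map_sub, map_sub, L.V.t_i, sub_eq_zero] at h

/-- The bracket of isomorphism classes. -/
def br : H →ₗ[K] H →ₗ[K] H := (L.br₀.compl₁₂ S.σ S.σ).compr₂ S.π

theorem br_apply (x y : H) : S.br x y = S.π (L.br₀ (S.σ x) (S.σ y)) := rfl

/-- The arrow part of an arrow from the bracket of representatives to the representative of the
bracket. -/
def corr : H →ₗ[K] H →ₗ[K] L.V.Arr :=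
  (S.br.compr₂ S.σ - L.br₀.compl₁₂ S.σ S.σ).compr₂ S.lift

theorem corr_apply (x y : H) : S.corr x y = S.lift (S.σ (S.br x y) - L.br₀ (S.σ x) (S.σ y)) := rfl

theorem s_corr (x y : H) : L.V.s (S.corr x y) = 0 := S.s_lift _

theorem t_corr (x y : H) : L.V.t (S.corr x y) = S.σ (S.br x y) - L.br₀ (S.σ x) (S.σ y) :=
  S.t_lift (S.σ (S.br x y) - L.br₀ (S.σ x) (S.σ y)) (by rw [map_sub, S.π_σ, br_apply, sub_self])

theorem σ_br (x y : H) : S.σ (S.br x y) = L.br₀ (S.σ x) (S.σ y) + L.V.t (S.corr x y) := by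
  rw [t_corr]; abel

theorem br_skew (x y : H) : S.br x y = -S.br y x := by
  rw [br_apply, L.br₀_skew, map_neg, ← br_apply]

theorem corr_skew (x y : H) : S.corr x y = -S.corr y x := by
  rw [corr_apply, corr_apply, S.br_skew, L.br₀_skew, ← map_neg S.lift, map_neg]
  congr 1
  abel

theorem π_br_t_left {a : L.V.Arr} (ha : L.V.s a = 0) (x : L.V.Obj) :
    S.π (L.br₀ (L.V.t a) x) = 0 := by
  have h := S.π_t (L.br₁ a (L.V.i x)) (by rw [L.s_br, ha, map_zero, LinearMap.zero_apply])
  rwa [L.t_br, L.V.t_i] at h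

theorem br_br (x y z : H) : S.br (S.br x y) z = S.π (L.br₀ (L.br₀ (S.σ x) (S.σ y)) (S.σ z)) := by
  rw [br_apply, σ_br, map_add, LinearMap.add_apply, map_add, S.π_br_t_left (S.s_corr x y), add_zero]

/-- The Jacobiator is an arrow between the two sides, and arrows join objects of the same class. -/
theorem jacobi (x y z : H) : S.br (S.br x y) z = S.br x (S.br y z) + S.br (S.br x z) y := by
  rw [S.br_skew x (S.br y z), br_br, br_br, br_br, ← map_neg, ← L.br₀_skew, ← map_add, ← L.t_J,
    π_t_eq, L.s_J]

theorem s_br_ι (x : H) (v : V) : L.V.s (L.whisker (S.σ x) (S.ι v)) = 0 := by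
  rw [L.s_whisker, S.s_ι, map_zero]

theorem t_br_ι (x : H) (v : V) : L.V.t (L.whisker (S.σ x) (S.ι v)) = 0 := by
  rw [L.t_whisker, S.t_ι, map_zero]

/-- The action of isomorphism classes of objects on automorphisms of `0`. -/
def act : H →ₗ[K] V →ₗ[K] V := (L.whisker.compl₁₂ S.σ S.ι).compr₂ S.κ

theorem ι_act (x : H) (v : V) : S.ι (S.act x v) = L.whisker (S.σ x) (S.ι v) :=
  S.ι_κ _ (S.s_br_ι x v) (S.t_br_ι x v)

theorem ι_injective : Function.Injective S.ι := Function.LeftInverse.injective S.κ_ι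

/-- By `jac_t` the failure to be an action is the Jacobiator at the target of `ι v`, which is `0`.
-/
theorem whisker_br (x y : L.V.Obj) (v : V) : L.whisker (L.br₀ x y) (S.ι v) =
    L.whisker x (L.whisker y (S.ι v)) - L.whisker y (L.whisker x (S.ι v)) := by
  have h := L.jac_t (S.s_ι v) x y
  rw [S.t_ι, map_zero, LinearMap.zero_apply, LinearMap.zero_apply] at h
  linear_combination (norm := abel) h

theorem whisker_t_ι {a : L.V.Arr} (ha : L.V.s a = 0) (v : V) : L.whisker (L.V.t a) (S.ι v) = 0 := by
  rw [L.whisker_t_skew ha (S.s_ι v), S.t_ι, map_zero, LinearMap.zero_apply, neg_zero]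

theorem act_br (x y : H) (v : V) : S.act (S.br x y) v = S.act x (S.act y v) - S.act y (S.act x v) :=
  S.ι_injective (by
    rw [map_sub, ι_act, ι_act, ι_act, ι_act, ι_act, σ_br, map_add, LinearMap.add_apply, whisker_br,
      S.whisker_t_ι (S.s_corr x y), add_zero])

/-- The loop formed by the Jacobiator and the arrows to the representatives of the brackets. -/
def loop : H →ₗ[K] H →ₗ[K] H →ₗ[K] L.V.Arr :=
  LinearMap.mk₂ K (fun x y => (L.jac (S.σ x) (S.σ y)) ∘ₗ S.σ + L.whisker (S.σ x) ∘ₗ S.corr y -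
      L.whisker (S.σ y) ∘ₗ S.corr x + L.whisker.flip (S.corr x y) ∘ₗ S.σ + S.corr x ∘ₗ S.br y +
      S.corr.flip y ∘ₗ S.br x - S.corr (S.br x y))
    (fun x x' y => LinearMap.ext fun z => by simp; abel)
    (fun c x y => LinearMap.ext fun z => by simp [smul_sub])
    (fun x y y' => LinearMap.ext fun z => by simp; abel)
    (fun c x y => LinearMap.ext fun z => by simp [smul_sub])

theorem loop_apply (x y z : H) : S.loop x y z = L.jac (S.σ x) (S.σ y) (S.σ z) +
    L.whisker (S.σ x) (S.corr y z) - L.whisker (S.σ y) (S.corr x z) +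
    L.whisker (S.σ z) (S.corr x y) + S.corr x (S.br y z) + S.corr (S.br x z) y -
    S.corr (S.br x y) z := rfl

theorem s_loop (x y z : H) : L.V.s (S.loop x y z) = 0 := by
  simp only [loop_apply, map_add, map_sub, L.s_jac, L.s_whisker, s_corr, map_zero, add_zero, sub_zero]

/-- The corrections `corr` are chosen so that the targets add up to the Jacobi identity in `H`,
carried to objects by `σ`. -/
theorem t_loop (x y z : H) : L.V.t (S.loop x y z) = 0 := by
  have h := congrArg S.σ (S.jacobi x y z)
  simp only [loop_apply, map_add, map_sub, L.t_jac, L.t_whisker, t_corr] at h ⊢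
  rw [L.br₀_skew (S.σ y) (S.σ (S.br x z)), L.br₀_skew (S.σ z) (S.σ (S.br x y)),
    L.br₀_skew (S.σ y) (L.br₀ _ _), L.br₀_skew (S.σ z) (L.br₀ _ _)]
  linear_combination (norm := abel) -h

/-- The cocycle of the skeletal model. -/
def om : H →ₗ[K] H →ₗ[K] H →ₗ[K] V := S.loop.compr₂ (LinearMap.llcomp K H L.V.Arr V S.κ)

theorem ι_om (x y z : H) : S.ι (S.om x y z) = S.loop x y z :=
  S.ι_κ _ (S.s_loop x y z) (S.t_loop x y z)

theorem loop_swap_left (x y z : H) : S.loop y x z = -S.loop x y z := by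
  simp only [loop_apply, L.jac_swap_left (S.σ x), S.corr_skew y x, S.br_skew y x, map_neg,
    LinearMap.neg_apply, S.corr_skew y (S.br x z), S.corr_skew (S.br y z) x]
  abel

theorem loop_swap_right (x y z : H) : S.loop x z y = -S.loop x y z := by
  simp only [loop_apply, L.jac_swap_right _ (S.σ y), S.corr_skew z y, S.br_skew z y, map_neg]
  abel

/-- The Jacobiator identity at representatives, plus a coboundary of `corr`. Replacing `σ (br x y)`
by `br₀ (σ x) (σ y)` costs Jacobiators at targets of `corr`, rewritten by `jac_t`. Terms quadratic
in `corr` cancel in pairs by `whisker_t_skew`, the linear ones by the Jacobi identity in `H`. -/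
theorem loop_cocycle (w x y z : H) :
    S.loop (S.br w x) y z - L.whisker (S.σ y) (S.loop w x z) + S.loop w (S.br x z) y +
        S.loop (S.br w z) x y + S.loop w x (S.br y z) =
      -L.whisker (S.σ z) (S.loop w x y) + S.loop (S.br w y) x z + S.loop w (S.br x y) z -
        L.whisker (S.σ x) (S.loop w y z) + L.whisker (S.σ w) (S.loop x y z) := by
  have h := L.jac_identity (S.σ w) (S.σ x) (S.σ y) (S.σ z)
  have h₁ := L.whisker_t_skew (S.s_corr w x) (S.s_corr y z)
  have h₂ := L.whisker_t_skew (S.s_corr w y) (S.s_corr x z)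
  have h₃ := L.whisker_t_skew (S.s_corr w z) (S.s_corr x y)
  have j₁ := congrArg (S.corr · y) (S.jacobi w x z)
  have j₂ := congrArg (S.corr · z) (S.jacobi w x y)
  have j₃ := congrArg (S.corr w) (S.jacobi x y z)
  have j₄ := congrArg (S.corr · x) (S.jacobi w y z)
  simp only [map_add, LinearMap.add_apply] at j₁ j₂ j₃ j₄
  simp only [loop_apply, σ_br, map_add, map_sub, LinearMap.add_apply, L.jac_t (S.s_corr _ _),
    L.jac_t_mid (S.s_corr _ _), L.jac_t_right (S.s_corr _ _)]
  linear_combination (norm := abel) h + h₁ - h₂ + h₃ + j₁ - j₂ - j₃ - j₄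

/-- The cocycle of a semi-strict Lie `2`-algebra. -/
def cocycleData : CocycleData K H V where
  br := S.br
  act := S.act
  om := S.om
  br_skew := S.br_skew
  jacobi := S.jacobi
  act_br := S.act_br
  om_swap_left x y z := S.ι_injective (by rw [map_neg, ι_om, ι_om, loop_swap_left])
  om_swap_right x y z := S.ι_injective (by rw [map_neg, ι_om, ι_om, loop_swap_right])
  cocycle w x y z := S.ι_injective (by
    simp only [map_add, map_sub, map_neg, ι_act, ι_om]
    exact S.loop_cocycle w x y z)

/-- The inclusion of the arrows of the skeletal model. -/
def fromSkeletalArr : H × V →ₗ[K] L.V.Arr := (L.V.i ∘ₗ S.σ).coprod S.ι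

theorem fromSkeletalArr_apply (f : H × V) :
    S.fromSkeletalArr f = L.V.i (S.σ f.1) + S.ι f.2 := rfl

theorem s_fromSkeletalArr (f : H × V) : L.V.s (S.fromSkeletalArr f) = S.σ f.1 := by
  rw [fromSkeletalArr_apply, map_add, L.V.s_i, S.s_ι, add_zero]

theorem t_fromSkeletalArr (f : H × V) : L.V.t (S.fromSkeletalArr f) = S.σ f.1 := by
  rw [fromSkeletalArr_apply, map_add, L.V.t_i, S.t_ι, add_zero]

theorem br_ι_ι (v w : V) : L.br₁ (S.ι v) (S.ι w) = 0 := L.br_kernels_eq_zero (S.s_ι v) (S.t_ι w)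

/-- The compatibility of the inclusion of the skeletal model with the brackets. -/
def fromSkeletalBr : H →ₗ[K] H →ₗ[K] L.V.Arr := (L.br₀.compl₁₂ S.σ S.σ).compr₂ L.V.i + S.corr

theorem fromSkeletalBr_apply (x y : H) :
    S.fromSkeletalBr x y = L.V.i (L.br₀ (S.σ x) (S.σ y)) + S.corr x y := rfl

theorem s_fromSkeletalBr (x y : H) : L.V.s (S.fromSkeletalBr x y) = L.br₀ (S.σ x) (S.σ y) := by
  rw [fromSkeletalBr_apply, map_add, L.V.s_i, s_corr, add_zero]

theorem t_fromSkeletalBr (x y : H) : L.V.t (S.fromSkeletalBr x y) = S.σ (S.br x y) := by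
  rw [fromSkeletalBr_apply, map_add, L.V.t_i, σ_br]

/-- The inclusion of the skeletal model. -/
def fromSkeletal : Hom S.cocycleData.skeletal L where
  obj := S.σ
  arr := S.fromSkeletalArr
  s_arr := S.s_fromSkeletalArr
  t_arr := S.t_fromSkeletalArr
  arr_i (x : H) := by
    change L.V.i (S.σ x) + S.ι 0 = L.V.i (S.σ x)
    rw [map_zero, add_zero]
  arr_comp (f f' : H × V) h := by
    have h : f.1 = f'.1 := h
    rw [TwoVectorSpace.comp_eq]
    change L.V.i (S.σ f.1) + S.ι (f.2 + f'.2) = L.V.i (S.σ f.1) + S.ι f.2 +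
      (L.V.i (S.σ f'.1) + S.ι f'.2) - L.V.i (L.V.t (S.fromSkeletalArr f))
    rw [t_fromSkeletalArr, map_add, h]
    abel
  F₂ := S.fromSkeletalBr
  s_F₂ := S.s_fromSkeletalBr
  t_F₂ := S.t_fromSkeletalBr
  F₂_natural (f f' : H × V) := by
    rw [TwoVectorSpace.comp_eq, TwoVectorSpace.comp_eq]
    change L.br₁ (S.fromSkeletalArr f) (S.fromSkeletalArr f') + S.fromSkeletalBr f.1 f'.1 -
        L.V.i (L.V.t (L.br₁ (S.fromSkeletalArr f) (S.fromSkeletalArr f'))) =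
      S.fromSkeletalBr f.1 f'.1 + (L.V.i (S.σ (S.br f.1 f'.1)) +
        S.ι (S.act f.1 f'.2 - S.act f'.1 f.2)) - L.V.i (L.V.t (S.fromSkeletalBr f.1 f'.1))
    rw [L.t_br, t_fromSkeletalArr, t_fromSkeletalArr, t_fromSkeletalBr]
    simp only [fromSkeletalArr_apply, map_add, LinearMap.add_apply, L.br_i, L.br_i_right,
      br_ι_ι, map_sub, ι_act, L.whisker_apply]
    abel
  F₂_skew (x y : H) := by
    change S.fromSkeletalBr x y = -S.fromSkeletalBr y x
    rw [fromSkeletalBr_apply, fromSkeletalBr_apply, L.br₀_skew, S.corr_skew, map_neg]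
    abel
  F₂_jacobiator (x y z : H) := by
    simp only [TwoVectorSpace.comp_eq]
    change L.J (S.σ x) (S.σ y) (S.σ z) +
          (L.br₁ (L.V.i (S.σ x)) (S.fromSkeletalBr y z) +
            L.br₁ (S.fromSkeletalBr x z) (L.V.i (S.σ y))) -
          L.V.i (L.V.t (L.J (S.σ x) (S.σ y) (S.σ z))) +
        (S.fromSkeletalBr x (S.br y z) + S.fromSkeletalBr (S.br x z) y) -
        L.V.i (L.V.t (L.J (S.σ x) (S.σ y) (S.σ z) +
          (L.br₁ (L.V.i (S.σ x)) (S.fromSkeletalBr y z) +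
            L.br₁ (S.fromSkeletalBr x z) (L.V.i (S.σ y))) -
          L.V.i (L.V.t (L.J (S.σ x) (S.σ y) (S.σ z))))) =
      L.br₁ (S.fromSkeletalBr x y) (L.V.i (S.σ z)) + S.fromSkeletalBr (S.br x y) z -
          L.V.i (L.V.t (L.br₁ (S.fromSkeletalBr x y) (L.V.i (S.σ z)))) +
        (L.V.i (S.σ (S.br (S.br x y) z)) + S.ι (S.om x y z)) -
        L.V.i (L.V.t (L.br₁ (S.fromSkeletalBr x y) (L.V.i (S.σ z)) + S.fromSkeletalBr (S.br x y) z -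
          L.V.i (L.V.t (L.br₁ (S.fromSkeletalBr x y) (L.V.i (S.σ z))))))
    simp only [map_add, map_sub, L.t_J, L.t_br, L.V.t_i, t_fromSkeletalBr, ι_om, loop_apply]
    simp only [fromSkeletalBr_apply, L.J_eq, map_add, LinearMap.add_apply, L.br_i, L.br_i_right,
      ← L.whisker_apply, L.whisker_i]
    abel

theorem isWeakEquiv_fromSkeletal : S.fromSkeletal.IsWeakEquiv where
  ess_surj x := by
    refine ⟨S.π x, L.V.i (S.σ (S.π x)) + S.lift (x - S.σ (S.π x)), ?_, ?_⟩
    · rw [map_add, L.V.s_i, S.s_lift, add_zero]; rfl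
    · rw [map_add, L.V.t_i, S.t_lift _ (by rw [map_sub, S.π_σ, sub_self]), add_sub_cancel]
  faithful (f : H × V) hs _ h := by
    have hs : f.1 = 0 := hs
    have h : L.V.i (S.σ f.1) + S.ι f.2 = 0 := h
    rw [hs, map_zero, map_zero, zero_add, ← map_zero S.ι] at h
    exact Prod.ext hs (S.ι_injective h)
  full (x y : H) f hs ht := by
    have hs : L.V.s f = S.σ x := hs
    have ht : L.V.t f = S.σ y := ht
    -- An arrow between chosen representatives is an automorphism, and its arrow part is an
    -- automorphism of `0`.
    have hxy : x = y := by rw [← S.π_σ x, ← S.π_σ y, ← hs, ← ht, π_t_eq]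
    refine ⟨((x, S.κ (f - L.V.i (S.σ x))) : H × V), rfl, hxy, ?_⟩
    change L.V.i (S.σ x) + S.ι (S.κ (f - L.V.i (S.σ x))) = f
    rw [S.ι_κ _ (by rw [map_sub, hs, L.V.s_i, sub_self])
      (by rw [map_sub, ht, L.V.t_i, hxy, sub_self]), add_sub_cancel]

end SkeletonData

end SemistrictLieTwoAlgebra

/-! ### Comparison of the skeletal and the strict model, and conclusion -/

namespace CocycleData

open FormalFun

variable {K : Type v} [Field K] [CharZero K] {g V : Type u} [AddCommGroup g] [Module K g]
    [AddCommGroup V] [Module K V] (A : CocycleData K g V)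

/-- Every class in `F / V` is the target of a formal function starting at `0`, and a formal function
whose class is zero is a unique constant. -/
theorem isWeakEquiv_skeletalToStrict : A.skeletalToStrict.IsWeakEquiv where
  ess_surj (x : g × FunQuot K g V) := by
    obtain ⟨φ, hφ⟩ := Submodule.mkQ_surjective _ x.2
    exact ⟨x.1, ((x.1, 0, φ) : g × FunQuot K g V × FormalFun K g V), rfl,
      Prod.ext rfl ((zero_add _).trans hφ)⟩
  faithful (f : g × V) hs _ h := by
    have h : const (K := K) (g := g) f.2 = 0 := congrArg (fun e : A.strict.Arr => e.2.2) h
    exact Prod.ext hs (congrArg (fun φ : FormalFun K g V => φ 0) h)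
  full (x y : g) (f : g × FunQuot K g V × FormalFun K g V) hs ht := by
    have hs₁ : f.1 = x := congrArg (fun e : A.strict.Obj => e.1) hs
    have hs₂ : f.2.1 = 0 := congrArg (fun e : A.strict.Obj => e.2) hs
    have ht₁ : f.1 = y := congrArg (fun e : A.strict.Obj => e.1) ht
    have ht₂ : f.2.1 + A.toQuot f.2.2 = 0 := congrArg (fun e : A.strict.Obj => e.2) ht
    rw [hs₂, zero_add] at ht₂
    obtain ⟨v, hv⟩ := (Submodule.Quotient.mk_eq_zero _).1 ht₂
    exact ⟨((x, v) : g × V), rfl, hs₁.symm.trans ht₁, Prod.ext hs₁.symm (Prod.ext hs₂.symm hv)⟩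

end CocycleData
end LieTwo

/-- Every semi-strict Lie `2`-algebra `L` over a field of characteristic `0` is equivalent to a
strict Lie `2`-algebra `S` whose crossed module `μ : h → g` has `h` abelian, and in this crossed
module `h` is a `g / μ(h)`-module and the outer action is a genuine action. -/
theorem mainTheorem4 {K : Type v} [Field K] [CharZero K]
    (L : LieTwo.SemistrictLieTwoAlgebra.{v, u} K) :
    ∃ S : LieTwo.StrictLieTwoAlgebra.{v, max u v} K,
      LieTwo.SemistrictLieTwoAlgebra.Equivalent L S.toSemistrict ∧
      IsLieAbelian S.crossedModule.h ∧
      S.crossedModule.IsCokerModule ∧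
      S.crossedModule.OuterActionIsGenuine := by
  obtain ⟨H, V, _, _, _, _, ⟨M⟩⟩ := L.nonempty_skeletonData
  -- The inclusion of the skeletal model points towards `L`; its inverse is composed with the map to
  -- the strict model.
  obtain ⟨G, hG, -, -⟩ := M.isWeakEquiv_fromSkeletal.exists_inverse
  let S := M.cocycleData.strict
  have hS : IsLieAbelian S.crossedModule.h := M.cocycleData.isLieAbelian_strict
  exact ⟨S, (hG.comp M.cocycleData.isWeakEquiv_skeletalToStrict).equivalent, hS,
    S.crossedModule.isCokerModule_of_isLieAbelian,
    S.crossedModule.outerActionIsGenuine_of_isLieAbelian⟩
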